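/- Let $X$ be a nonempty $\mathrm{CAT}(0)$ space. A *flat* in $X$ is the image of an isometric embedding $\mathbb{E}^k \to X$ of Euclidean space with $2 \le k < \infty$. Suppose that $X$ has *isolated flats* with respect to a family $\mathcal{F}$ of flats in $X$ (the *distinguished flats*); that is: 1. there is a constant $B$ such that every flat in $X$ is contained in the $B$-neighborhood of some $F' \in \mathcal{F}$; 2. there is a function $\psi : \mathbb{R}_{+} \to \mathbb{R}_{+}$ such that for every pair of distinct $F_1, F_2 \in \mathcal{F}$ and every $k \ge 0$, the intersection of the $k$-neighborhoods of $F_1$ and $F_2$ has diameter at most $\psi(k)$; 3. $\mathcal{F}$ is invariant under $\mathrm{Isom}(X)$. Let $G$ be a group acting geometrically on $X$, i.e. isometrically, properly discontinuously and cocompactly. Call a subgroup of $G$ *virtually abelian of rank at least two* if it has an abelian subgroup $A$ of finite index with $\dim_{\mathbb{Q}}(A \otimes_{\mathbb{Z}} \mathbb{Q}) \ge 2$. Then $G$ contains only finitely many conjugacy classes of maximal virtually abelian subgroups of rank at least two. Moreover, the set of these maximal subgroups is exactly the set of setwise stabilizers $\mathrm{Stab}_G(F) = \{g \in G : gF = F\}$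 of the flats $F \in \mathcal{F}$. -/

import Mathlib

open scoped Pointwise NNReal ENNReal

/-- `γ`, restricted to `[0, dist p q]`, is a geodesic from `p` to `q`: an isometric embedding of
the interval `[0, dist p q]` that starts at `p` and ends at `q`. (The values of `γ` outside this
interval play no role.) -/
structure IsGeodesicFromTo {X : Type*} [MetricSpace X] (γ : ℝ → X) (p q : X) : Prop where
  map_zero : γ 0 = p
  map_dist : γ (dist p q) = q
  dist_eq : ∀ s ∈ Set.Icc 0 (dist p q), ∀ t ∈ Set.Icc 0 (dist p q), dist (γ s) (γ t) = |s - t|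

/-- A CAT(0) space: a geodesic metric space in which the distance between two points on a geodesic
triangle is at most the distance of the corresponding points on a comparison triangle in the
Euclidean plane.

Two points on different sides of a geodesic triangle lie on two sides with a common vertex, which
is called `p` here; for two points on the same side the inequality is an equality. The points at
distance `s` and `t` from `p` on the sides `[p, q]` and `[p, r]` are `γ s` and `γ' t`, and `x'`,
`y'` are the corresponding points of the comparison triangle with vertices `p'`, `q'`, `r'`. -/
structure IsCAT0Space (X : Type*) [MetricSpace X] : Prop where
  exists_geodesic : ∀ p q : X, ∃ γ : ℝ → X, IsGeodesicFromTo γ p q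
  dist_le_comparison : ∀ (p q r : X) (γ γ' : ℝ → X),
    IsGeodesicFromTo γ p q → IsGeodesicFromTo γ' p r →
    ∀ p' q' r' : EuclideanSpace ℝ (Fin 2),
      dist p' q' = dist p q → dist p' r' = dist p r → dist q' r' = dist q r →
    ∀ s ∈ Set.Icc 0 (dist p q), ∀ t ∈ Set.Icc 0 (dist p r),
    ∀ x' ∈ segment ℝ p' q', ∀ y' ∈ segment ℝ p' r', dist p' x' = s → dist p' y' = t →
      dist (γ s) (γ' t) ≤ dist x' y'

/-- A geometric action: isometric, properly discontinuous (for all compact `K`, `L` only finitely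
many `g` satisfy `g K ∩ L ≠ ∅`) and cocompact (the translates of some compact set cover `X`). -/
structure IsGeometricAction (G X : Type*) [Group G] [MetricSpace X] [MulAction G X] : Prop where
  isometric : IsIsometricSMul G X
  properlyDiscontinuous : ProperlyDiscontinuousSMul G X
  cocompact : ∃ K : Set X, IsCompact K ∧ ⋃ g : G, g • K = Set.univ

/-- A flat: (the image of) an isometric embedding of a Euclidean space of some finite
dimension `k ≥ 2`. -/
def IsFlat {X : Type*} [MetricSpace X] (F : Set X) : Prop :=
  ∃ k : ℕ, 2 ≤ k ∧ ∃ f : EuclideanSpace ℝ (Fin k) → X, Isometry f ∧ Set.range f = F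

/-- `𝓕` is a distinguished family of flats that witnesses that `X` has isolated flats. Here
`Metric.cthickening r F` is the set of points at distance at most `r` from `F`. -/
structure IsIsolatedFlatsFamily {X : Type*} [MetricSpace X] (𝓕 : Set (Set X)) : Prop where
  isFlat : ∀ F ∈ 𝓕, IsFlat F
  /-- (Maximal) Every flat lies in a uniform neighborhood of a flat of the family. -/
  maximal : ∃ B : ℝ≥0, ∀ F : Set X, IsFlat F → ∃ F' ∈ 𝓕, F ⊆ Metric.cthickening B F'
  /-- (Isolated) The `k`-neighborhoods of two distinct flats of the family have an intersection of
  diameter at most `ψ k`. -/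
  isolated : ∃ ψ : ℝ≥0 → ℝ≥0, ∀ F₁ ∈ 𝓕, ∀ F₂ ∈ 𝓕, F₁ ≠ F₂ → ∀ k : ℝ≥0,
    Metric.ediam (Metric.cthickening (k : ℝ) F₁ ∩ Metric.cthickening (k : ℝ) F₂) ≤ ψ k
  /-- (Equivariant) The family is invariant under all isometries of `X`. -/
  equivariant : ∀ φ : X ≃ᵢ X, ∀ F ∈ 𝓕, φ '' F ∈ 𝓕

open scoped IsMulCommutative in
/-- `H` is virtually abelian of rank at least `n`: it has an abelian subgroup `A` of finite index
whose rank as a `ℤ`-module, that is `dim_ℚ (A ⊗ ℚ)`, is at least `n`. (All abelian subgroups of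
finite index in `H` have the same rank.) -/
def IsVirtuallyAbelianOfRankGE {G : Type*} [Group G] (n : ℕ) (H : Subgroup G) : Prop :=
  ∃ (A : Subgroup H) (_ : IsMulCommutative A), A.FiniteIndex ∧
    (n : Cardinal) ≤ Module.rank ℤ (Additive A)

/-- The set of maximal virtually abelian subgroups of `G` of rank at least two. -/
def maximalVirtuallyAbelianSubgroups (G : Type*) [Group G] : Set (Subgroup G) :=
  {H | Maximal (IsVirtuallyAbelianOfRankGE 2) H}

/-- The conjugacy class `{g H g⁻¹ | g ∈ G}` of a subgroup `H`. -/
def subgroupConjClass {G : Type*} [Group G] (H : Subgroup G) : Set (Subgroup G) :=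
  Set.range fun g : G => MulAut.conj g • H

/-! Two facts carry the theorem. Every virtually abelian subgroup of rank at least two stabilizes
some distinguished flat (`exists_le_stabilizer`), and every stabilizer of a distinguished flat is
virtually abelian of rank at least two (`isVirtuallyAbelianOfRankGE_stabilizer`). Hence a maximal
subgroup equals the stabilizer that contains it. Conversely, if Stab(F) ≤ H ≤ Stab(F'), the infinite
group Stab(F) preserves both flats, so an unbounded orbit stays close to both and isolation gives F
= F'. Finiteness up to conjugacy holds because each flat has a translate meeting a fixed compact
set, only finitely many flats do so (`finite_meeting`), and translating a flat conjugates its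
stabilizer.

The first fact needs a flat torus theorem for commuting a, b that generate ℤ². At a minimum of the
sum of their squared displacements, the orbit satisfies the parallelogram law, so it is a copy of a
planar lattice. Repeated midpoints and a compactness argument extend that copy to a flat plane. This
plane lies near a distinguished flat, which isolation makes invariant, first under the abelian
subgroup and then under all of H.

The second fact is Bieberbach's theorem. The stabilizer acts properly and coboundedly on its flat;
iterated commutators of elements with small rotation part contract, and discreteness then forces
small rotations to be trivial. The action may have a finite kernel, so translations need not
commute, but suitable powers do.

The CAT(0) condition enters only through geodesics, which give properness, and the CN inequality. -/

/-! ### Midpoints and the CN inequality. -/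

/-- `m` satisfies the Bruhat–Tits (CN) inequality of a midpoint of `y` and `z`. -/
def IsCNMidpoint {X : Type*} [MetricSpace X] (m y z : X) : Prop :=
  ∀ w, dist w m ^ 2 ≤ dist w y ^ 2 / 2 + dist w z ^ 2 / 2 - dist y z ^ 2 / 4

/-- The law of cosines: `p` is the origin, `q` lies on the first axis, and `u` is the abscissa of
`r`. As `u` has `D` in its denominator, `D = 0` is treated apart. -/
theorem exists_comparison_triangle {D e h : ℝ} (hD : 0 ≤ D) (he : 0 ≤ e) (hh : 0 ≤ h)
    (h1 : D ≤ e + h) (h2 : e ≤ D + h) (h3 : h ≤ D + e) :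
    ∃ p q r : EuclideanSpace ℝ (Fin 2), dist p q = D ∧ dist p r = e ∧ dist q r = h := by
  rcases hD.eq_or_lt with rfl | hD
  · have : e = h := by linarith
    subst this
    refine ⟨!₂[0, 0], !₂[0, 0], !₂[e, 0], by simp, ?_, ?_⟩ <;>
      simp [EuclideanSpace.dist_eq, Real.dist_eq, Real.sqrt_sq_eq_abs, abs_of_nonneg he]
  · set u := (D ^ 2 + e ^ 2 - h ^ 2) / (2 * D) with hu
    have hu' : 2 * D * u = D ^ 2 + e ^ 2 - h ^ 2 := by rw [hu]; field_simp
    have hue : u ^ 2 ≤ e ^ 2 := by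
      apply sq_le_sq'
      · rw [hu, le_div_iff₀ (by positivity)]; nlinarith
      · rw [hu, div_le_iff₀ (by positivity)]; nlinarith
    have hv : Real.sqrt (e ^ 2 - u ^ 2) ^ 2 = e ^ 2 - u ^ 2 := Real.sq_sqrt (by linarith)
    refine ⟨!₂[0, 0], !₂[D, 0], !₂[u, Real.sqrt (e ^ 2 - u ^ 2)], ?_, ?_, ?_⟩
    · simp [EuclideanSpace.dist_eq, Real.dist_eq, Real.sqrt_sq_eq_abs, abs_of_pos hD]
    · simp only [EuclideanSpace.dist_eq, Real.dist_eq, Fin.sum_univ_two, sq_abs]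
      simp [hv, Real.sqrt_sq_eq_abs, abs_of_nonneg he]
    · simp only [EuclideanSpace.dist_eq, Real.dist_eq, Fin.sum_univ_two, sq_abs]
      simp only [Matrix.cons_val_zero, Matrix.cons_val_one, zero_sub, neg_sq, hv]
      rw [show (D - u) ^ 2 + (e ^ 2 - u ^ 2) = h ^ 2 by linarith, Real.sqrt_sq hh]

/-- In the comparison triangle Apollonius' theorem gives the CN inequality as an equality; the
CAT(0) inequality for the midpoint of a side and the opposite vertex transfers it to `X`. -/
theorem IsCAT0Space.exists_isCNMidpoint {X : Type*} [MetricSpace X] (hX : IsCAT0Space X)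
    (y z : X) : ∃ m, IsCNMidpoint m y z := by
  obtain ⟨γ, hγ⟩ := hX.exists_geodesic y z
  refine ⟨γ (dist y z / 2), fun w => ?_⟩
  obtain ⟨γ', hγ'⟩ := hX.exists_geodesic y w
  obtain ⟨p, q, r, hpq, hpr, hqr⟩ := exists_comparison_triangle (dist_nonneg (x := y) (y := z))
    (dist_nonneg (x := y) (y := w)) (dist_nonneg (x := z) (y := w))
    (by simpa [dist_comm] using dist_triangle y w z) (dist_triangle y z w)
    (by simpa [dist_comm] using dist_triangle z y w)
  have key := hX.dist_le_comparison y z w γ γ' hγ hγ' p q r hpq hpr hqr (dist y z / 2)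
    ⟨by positivity, by linarith [dist_nonneg (x := y) (y := z)]⟩ (dist y w)
    ⟨dist_nonneg, le_rfl⟩ (midpoint ℝ p q) (midpoint_mem_segment p q) r (right_mem_segment ℝ p r)
    (by rw [dist_left_midpoint, hpq]; norm_num; ring) hpr
  rw [hγ'.map_dist] at key
  have apol := EuclideanGeometry.dist_sq_add_dist_sq_eq_two_mul_dist_midpoint_sq_add_half_dist_sq r p q
  rw [dist_comm w]
  have h4 : dist (γ (dist y z / 2)) w ^ 2 ≤ dist (midpoint ℝ p q) r ^ 2 := by gcongr
  rw [dist_comm r p, dist_comm r q, hpr, hqr, hpq, dist_comm r] at apol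
  rw [dist_comm w y, dist_comm w z]
  linarith

namespace IsCNMidpoint

variable {X : Type*} [MetricSpace X] {m w y z : X}

theorem dist_left (h : IsCNMidpoint m y z) : dist y m ≤ dist y z / 2 := by
  have := h y
  simp only [dist_self] at this
  exact abs_le_of_sq_le_sq' (by linarith) (by positivity) |>.2

theorem symm (h : IsCNMidpoint m y z) : IsCNMidpoint m z y := fun w => by
  rw [dist_comm z y]; linarith [h w]

theorem dist_right (h : IsCNMidpoint m y z) : dist z m ≤ dist y z / 2 := by
  rw [dist_comm y]; exact h.symm.dist_left

theorem dist_left_eq (h : IsCNMidpoint m y z) : dist y m = dist y z / 2 := by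
  have := dist_triangle_right y z m
  linarith [h.dist_left, h.dist_right]

theorem dist_right_eq (h : IsCNMidpoint m y z) : dist z m = dist y z / 2 := by
  have := dist_triangle_right y z m
  linarith [h.dist_left, h.dist_right]

theorem eq_of_dist_le (h : IsCNMidpoint m y z) (h1 : dist w y ≤ dist y z / 2)
    (h2 : dist w z ≤ dist y z / 2) : w = m := by
  have h3 := h w
  have h4 : dist w y ^ 2 ≤ (dist y z / 2) ^ 2 := by gcongr
  have h5 : dist w z ^ 2 ≤ (dist y z / 2) ^ 2 := by gcongr
  have : dist w m ^ 2 ≤ 0 := by nlinarith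
  exact dist_eq_zero.1 (pow_eq_zero_iff two_ne_zero |>.1 (le_antisymm this (sq_nonneg _)))

theorem smul {G : Type*} [Group G] [MulAction G X] [IsIsometricSMul G X] (h : IsCNMidpoint m y z)
    (g : G) : IsCNMidpoint (g • m) (g • y) (g • z) := fun w => by
  have := h (g⁻¹ • w)
  simpa only [← dist_smul g (g⁻¹ • w), smul_inv_smul, dist_smul] using this

end IsCNMidpoint

section

variable {X : Type*} [MetricSpace X]

/-- Midpoints are unique, so any metric midpoint inherits the CN inequality. This is how points
already known by their distances are used as midpoints below. -/
theorem isCNMidpoint_of_dist_le (hX : ∀ y z : X, ∃ m, IsCNMidpoint m y z) {w y z : X}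
    (h1 : dist w y ≤ dist y z / 2) (h2 : dist w z ≤ dist y z / 2) : IsCNMidpoint w y z := by
  obtain ⟨m, hm⟩ := hX y z
  rwa [hm.eq_of_dist_le h1 h2]

/-- The quadrilateral inequality: CAT(0) spaces have roundness two. -/
theorem dist_sq_add_dist_sq_le (hX : ∀ y z : X, ∃ m, IsCNMidpoint m y z) (x y z w : X) :
    dist x z ^ 2 + dist y w ^ 2 ≤ dist x y ^ 2 + dist y z ^ 2 + dist z w ^ 2 + dist w x ^ 2 := by
  obtain ⟨m, hm⟩ := hX x z
  have h1 := hm y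
  have h2 := hm w
  have h3 : dist y w ^ 2 ≤ (dist y m + dist w m) ^ 2 := by
    gcongr; exact dist_triangle_right y w m
  rw [dist_comm x y, dist_comm z w]
  nlinarith [sq_nonneg (dist y m - dist w m)]

theorem IsCNMidpoint.dist_midline_le {m m' x y z : X}
    (h : IsCNMidpoint m x y) (h' : IsCNMidpoint m' y z) :
    dist m m' ≤ dist x z / 2 := by
  have h1 := h' m
  have h2 := h z
  have h3 := h.dist_right
  have h4 : dist m y ^ 2 ≤ (dist x y / 2) ^ 2 := by
    rw [dist_comm m]; gcongr
  rw [dist_comm z m, dist_comm z x, dist_comm z y] at h2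
  refine abs_le_of_sq_le_sq' ?_ (by positivity) |>.2
  nlinarith

/-- Apply CN at `m'`, then CN at `m` to the two resulting terms; the quadrilateral inequality bounds
the diagonals that remain. -/
theorem IsCNMidpoint.dist_sq_le (hX : ∀ y z : X, ∃ m, IsCNMidpoint m y z) {m m' x y x' y' : X}
    (h : IsCNMidpoint m x y) (h' : IsCNMidpoint m' x' y') :
    dist m m' ^ 2 ≤ (dist x x' ^ 2 + dist y y' ^ 2) / 2 := by
  have h1 := h' m
  have h2 := h x'
  have h3 := h y'
  have h4 := dist_sq_add_dist_sq_le hX x y y' x'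
  rw [dist_comm m x', dist_comm m y'] at h1
  rw [dist_comm x' x, dist_comm x' y] at h2
  rw [dist_comm y' x, dist_comm y' y] at h3
  rw [dist_comm x' x, dist_comm y' x'] at h4
  linarith

end

/-! ### Extending isometric embeddings from a lattice to Euclidean space. -/

section Lattice

variable {X V : Type*} [MetricSpace X] [NormedAddCommGroup V] [InnerProductSpace ℝ V]

theorem norm_add_sq_add_norm_sub_sq (v w : V) :
    ‖v + w‖ ^ 2 + ‖v - w‖ ^ 2 = 2 * (‖v‖ ^ 2 + ‖w‖ ^ 2) := by
  simpa only [sq] using parallelogram_law_with_norm ℝ v w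

/-- An isometric embedding of a subgroup `Λ` of a Euclidean space into a space with CN midpoints
extends to `½ Λ`. -/
theorem exists_isometricOn_half (hX : ∀ y z : X, ∃ m, IsCNMidpoint m y z) (Λ : AddSubgroup V)
    (f : V → X) (hf : ∀ v ∈ Λ, ∀ w ∈ Λ, dist (f v) (f w) = ‖v - w‖) :
    ∃ f' : V → X, (∀ v ∈ Λ, f' v = f v) ∧
      ∀ v w, v + v ∈ Λ → w + w ∈ Λ → dist (f' v) (f' w) = ‖v - w‖ := by
  choose mid hmid using hX
  have hX : ∀ y z : X, ∃ m, IsCNMidpoint m y z := fun y z => ⟨_, hmid y z⟩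
  have norm_double (v : V) : ‖v + v‖ = 2 * ‖v‖ := by
    rw [← two_smul ℝ, norm_smul]; simp
  set f' : V → X := fun w => mid (f 0) (f (w + w)) with hf'
  have hm (w : V) : IsCNMidpoint (f' w) (f 0) (f (w + w)) := hmid _ _
  have h0 (w : V) (hw : w + w ∈ Λ) : dist (f 0) (f (w + w)) = 2 * ‖w‖ := by
    rw [hf _ Λ.zero_mem _ hw, zero_sub, norm_neg, norm_double]
  have hmidpt (g h : V) (hg : g ∈ Λ) (hh : h ∈ Λ) : IsCNMidpoint (f g) (f (g + h)) (f (g - h)) := by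
    have e1 : g + h - (g - h) = h + h := by abel
    apply isCNMidpoint_of_dist_le hX <;>
    rw [hf _ (Λ.add_mem hg hh) _ (Λ.sub_mem hg hh), hf _ hg _ (by first | exact Λ.add_mem hg hh | exact Λ.sub_mem hg hh), e1,
      norm_double]
    · rw [sub_add_cancel_left, norm_neg]; linarith
    · rw [sub_sub_cancel]; linarith
  -- the new points are at the right distance from the old ones
  have hle (w : V) (hw : w + w ∈ Λ) (g : V) (hg : g ∈ Λ) :
      dist (f' w) (f g) ^ 2 ≤ ‖w - g‖ ^ 2 := by
    have h1 := hm w (f g)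
    rw [h0 w hw, hf _ hg _ Λ.zero_mem, hf _ hg _ hw, sub_zero, dist_comm] at h1
    have h2 := norm_add_sq_add_norm_sub_sq (w - g) w
    have e1 : ‖w - g + w‖ = ‖g - (w + w)‖ := by rw [← norm_neg]; congr 1; abel
    have e2 : ‖w - g - w‖ = ‖g‖ := by rw [← norm_neg]; congr 1; abel
    rw [e1, e2] at h2
    linarith
  have heq (w : V) (hw : w + w ∈ Λ) (g : V) (hg : g ∈ Λ) :
      dist (f' w) (f g) ^ 2 = ‖w - g‖ ^ 2 := by
    -- Reflection: `f 0` is a midpoint of `f g` and `f (-g)`, so CN turns the upper bound for the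
    -- distance to `f (-g)` into a lower bound for the distance to `f g`.
    refine le_antisymm (hle w hw g hg) ?_
    have h1 := hmidpt 0 g Λ.zero_mem hg (f' w)
    have h2 := hle w hw (0 - g) (Λ.sub_mem Λ.zero_mem hg)
    rw [hf _ (Λ.add_mem Λ.zero_mem hg) _ (Λ.sub_mem Λ.zero_mem hg), dist_comm _ (f 0),
      (hm w).dist_left_eq, h0 w hw] at h1
    have h3 := norm_add_sq_add_norm_sub_sq w g
    have e1 : (0 : V) + g - (0 - g) = g + g := by abel
    rw [e1, norm_double, zero_add] at h1
    rw [show w - (0 - g) = w + g by abel] at h2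
    linarith
  have hle' (v w : V) (hv : v + v ∈ Λ) (hw : w + w ∈ Λ) :
      dist (f' v) (f' w) ^ 2 ≤ ‖v - w‖ ^ 2 := by
    have h1 := hm w (f' v)
    rw [h0 w hw, heq v hv _ Λ.zero_mem, heq v hv _ hw, sub_zero] at h1
    have h2 := norm_add_sq_add_norm_sub_sq (v - w) w
    rw [show v - w - w = v - (w + w) by abel, sub_add_cancel] at h2
    linarith
  have hneg (w : V) (hw : w + w ∈ Λ) : -w + -w ∈ Λ := by
    rw [← neg_add]; exact Λ.neg_mem hw
  refine ⟨f', fun v hv => ?_, fun v w hv hw => ?_⟩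
  · have h1 := heq v (Λ.add_mem hv hv) v hv
    rw [sub_self, norm_zero] at h1
    exact dist_eq_zero.1 (pow_eq_zero_iff two_ne_zero |>.1 (by rw [h1]; simp))
  · refine (sq_eq_sq₀ dist_nonneg (norm_nonneg _)).1 (le_antisymm (hle' v w hv hw) ?_)
    have h0w : dist (f 0) (f' w) = ‖w‖ := by rw [(hm w).dist_left_eq, h0 w hw]; ring
    have h0w' : dist (f 0) (f' (-w)) = ‖w‖ := by
      rw [(hm (-w)).dist_left_eq, h0 _ (hneg w hw), norm_neg]; ring
    have h0v : dist (f' v) (f 0) = ‖v‖ := by rw [dist_comm, (hm v).dist_left_eq, h0 v hv]; ring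
    -- The points `f (w + w)` and `f (-w + -w)` are `4 * ‖w‖` apart, and the path between them
    -- through `f' w` and `f' (-w)` has outer legs of length `‖w‖`. Hence `f 0` is also the midpoint
    -- of `f' w` and `f' (-w)`, and the reflection argument applies again.
    have hww : dist (f' w) (f' (-w)) = 2 * ‖w‖ := by
      apply le_antisymm
      · linarith [dist_triangle_left (f' w) (f' (-w)) (f 0)]
      · have h1 := dist_triangle4 (f (w + w)) (f' w) (f' (-w)) (f (-w + -w))
        rw [(hm w).dist_right_eq, h0 w hw, dist_comm (f' (-w)) (f (-w + -w)), (hm (-w)).dist_right_eq,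
          h0 _ (hneg w hw), hf _ hw _ (hneg w hw), norm_neg,
          show w + w - (-w + -w) = (w + w) + (w + w) by abel, norm_double, norm_double] at h1
        linarith
    have hc : IsCNMidpoint (f 0) (f' w) (f' (-w)) := by
      apply isCNMidpoint_of_dist_le hX <;> rw [hww] <;> linarith
    have h1 := hc (f' v)
    have h2 := hle' v (-w) hv (hneg w hw)
    have h3 := norm_add_sq_add_norm_sub_sq v w
    rw [sub_neg_eq_add] at h2
    rw [h0v, hww] at h1
    linarith

theorem exists_isometricOn_dyadic (hX : ∀ y z : X, ∃ m, IsCNMidpoint m y z) (Λ : AddSubgroup V)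
    (f : V → X) (hf : ∀ v ∈ Λ, ∀ w ∈ Λ, dist (f v) (f w) = ‖v - w‖) (n : ℕ) :
    ∃ f' : V → X, (∀ v ∈ Λ, f' v = f v) ∧
      ∀ v w, 2 ^ n • v ∈ Λ → 2 ^ n • w ∈ Λ → dist (f' v) (f' w) = ‖v - w‖ := by
  induction n with
  | zero => exact ⟨f, fun _ _ => rfl, fun v w hv hw => hf v (by simpa using hv) w (by simpa using hw)⟩
  | succ n ih =>
    obtain ⟨f₁, h1, h2⟩ := ih
    obtain ⟨f₂, h3, h4⟩ := exists_isometricOn_half hX (Λ.comap (DistribSMul.toAddMonoidHom V (2 ^ n)))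
      f₁ (fun v hv w hw => h2 v w hv hw)
    have key (v : V) (hv : 2 ^ (n + 1) • v ∈ Λ) :
        v + v ∈ Λ.comap (DistribSMul.toAddMonoidHom V (2 ^ n)) := by
      rw [AddSubgroup.mem_comap, DistribSMul.toAddMonoidHom_apply, ← two_nsmul, smul_smul, ← pow_succ]
      exact hv
    refine ⟨f₂, fun v hv => ?_, fun v w hv hw => h4 v w (key v hv) (key w hw)⟩
    rw [h3 v (Λ.nsmul_mem hv _), h1 v hv]

open Filter Topology in
/-- An isometric embedding into a proper CAT(0) space of a cobounded subgroup of a Euclidean space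
extends to the whole Euclidean space. -/
theorem exists_isometry_extending [ProperSpace X] (hX : ∀ y z : X, ∃ m, IsCNMidpoint m y z)
    (Λ : AddSubgroup V) {C : ℝ} (hΛ : ∀ v : V, ∃ w ∈ Λ, ‖v - w‖ ≤ C)
    (f : V → X) (hf : ∀ v ∈ Λ, ∀ w ∈ Λ, dist (f v) (f w) = ‖v - w‖) :
    ∃ f' : V → X, Isometry f' ∧ ∀ v ∈ Λ, f' v = f v := by
  choose F hF1 hF2 using exists_isometricOn_dyadic hX Λ f hf
  have happrox (n : ℕ) (v : V) : ∃ w, 2 ^ n • w ∈ Λ ∧ ‖v - w‖ ≤ C * (1 / 2) ^ n := by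
    obtain ⟨w, hw, hvw⟩ := hΛ ((2 : ℝ) ^ n • v)
    refine ⟨((2 : ℝ) ^ n)⁻¹ • w, ?_, ?_⟩
    · rw [← Nat.cast_smul_eq_nsmul ℝ, smul_smul]
      simpa using hw
    · have : v - ((2 : ℝ) ^ n)⁻¹ • w = ((2 : ℝ) ^ n)⁻¹ • ((2 : ℝ) ^ n • v - w) := by
        rw [smul_sub, smul_smul]; simp
      rw [this, norm_smul, norm_inv, norm_pow, Real.norm_ofNat, one_div, inv_pow, mul_comm]
      gcongr
  choose a ha1 ha2 using happrox
  have hC : 0 ≤ C := (norm_nonneg _).trans (hΛ 0).choose_spec.2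
  have hlim (v : V) : Tendsto (fun n => a n v) atTop (𝓝 v) := by
    rw [tendsto_iff_norm_sub_tendsto_zero]
    refine squeeze_zero (fun _ => norm_nonneg _) (fun n => (norm_sub_rev _ _).trans_le (ha2 n v)) ?_
    simpa using (tendsto_pow_atTop_nhds_zero_of_lt_one (r := (1 / 2 : ℝ)) (by norm_num)
      (by norm_num)).const_mul C
  -- The maps `F n` are chosen independently and are only known to agree on `Λ`. A limit along an
  -- ultrafilter replaces compatibility: it exists by properness and preserves distances.
  have hconv (v : V) : ∃ y, Tendsto (fun n => F n (a n v)) (hyperfilter ℕ) (𝓝 y) := by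
    have hK : IsCompact (Metric.closedBall (f 0) (‖v‖ + C)) := isCompact_closedBall _ _
    obtain ⟨y, -, hy⟩ := hK.ultrafilter_le_nhds ((hyperfilter ℕ : Ultrafilter ℕ).map
      (fun n => F n (a n v))) (by
        rw [le_principal_iff, Ultrafilter.coe_map, Filter.mem_map]
        refine Filter.mem_of_superset univ_mem fun n _ => ?_
        rw [Set.mem_preimage, Metric.mem_closedBall, ← hF1 n 0 Λ.zero_mem,
          hF2 n _ _ (ha1 n v) (by simp), sub_zero]
        have h1 : ‖a n v‖ ≤ ‖v‖ + ‖v - a n v‖ := by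
          have := norm_sub_le v (v - a n v); rwa [sub_sub_cancel] at this
        have h2 : C * (1 / 2) ^ n ≤ C * 1 := by
          gcongr; exact pow_le_one₀ (by norm_num) (by norm_num)
        linarith [ha2 n v])
    exact ⟨y, hy⟩
  choose f' hf' using hconv
  have hle : (hyperfilter ℕ : Filter ℕ) ≤ atTop := Nat.hyperfilter_le_atTop
  refine ⟨f', Isometry.of_dist_eq fun v w => ?_, fun v hv => ?_⟩
  · refine tendsto_nhds_unique ((hf' v).dist (hf' w)) ?_
    rw [dist_eq_norm]
    refine Tendsto.congr (fun n => (hF2 n _ _ (ha1 n v) (ha1 n w)).symm) ?_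
    exact (((hlim v).sub (hlim w)).norm).mono_left hle
  · refine tendsto_nhds_unique (hf' v) ?_
    rw [tendsto_iff_dist_tendsto_zero]
    refine Tendsto.congr (f₁ := fun n => ‖a n v - v‖) (fun n => ?_) ?_
    · rw [← hF1 n v hv, hF2 n _ _ (ha1 n v) (Λ.nsmul_mem hv _)]
    · exact ((tendsto_iff_norm_sub_tendsto_zero.1 (hlim v))).mono_left hle

end Lattice

/-! ### Geometric actions and properness of the space. -/

theorem IsGeometricAction.finite_smul_inter {G X : Type*} [Group G] [MetricSpace X]
    [MulAction G X] (hG : IsGeometricAction G X) {K L : Set X} (hK : IsCompact K)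
    (hL : IsCompact L) : {g : G | ∃ x ∈ K, g • x ∈ L}.Finite := by
  refine (hG.properlyDiscontinuous.finite_disjoint_inter_image hK hL).subset ?_
  rintro g ⟨x, hx, hgx⟩
  exact ⟨g • x, ⟨x, hx, rfl⟩, hgx⟩

theorem IsGeometricAction.exists_smul_mem {G X : Type*} [Group G] [MetricSpace X]
    [MulAction G X] {K : Set X} (hK : ⋃ g : G, g • K = Set.univ) (x : X) : ∃ g : G, g • x ∈ K := by
  have : x ∈ ⋃ g : G, g • K := hK ▸ Set.mem_univ x
  obtain ⟨g, hg⟩ := Set.mem_iUnion.1 this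
  exact ⟨g⁻¹, Set.mem_smul_set_iff_inv_smul_mem.1 hg⟩

open Filter Topology in
/-- A space with a geometric action is locally compact. -/
theorem IsGeometricAction.exists_isCompact_mem_nhds {G X : Type*} [Group G] [MetricSpace X]
    [MulAction G X] (hG : IsGeometricAction G X) (v : X) : ∃ L, IsCompact L ∧ L ∈ 𝓝 v := by
  have := hG.isometric
  obtain ⟨K, hK, hKX⟩ := hG.cocompact
  have hcl (g : G) : IsCompact (g • K) := hK.smul g
  by_contra! hcon
  classical
  -- Without a compact neighborhood of `v`, finitely many translates of `K` never cover a ball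
  -- around `v`. This yields distinct group elements moving points of `K` to a sequence converging
  -- to `v`, against proper discontinuity for `K` and that sequence with its limit.
  have hstep (s : Finset G) (n : ℕ) :
      ∃ g : G, g ∉ s ∧ ∃ x ∈ K, dist (g • x) v < 1 / (n + 1 : ℝ) := by
    have h1 : (⋃ g ∈ s, g • K) ∉ 𝓝 v := hcon _ (s.isCompact_biUnion fun g _ => hcl g)
    have h2 : ¬ Metric.ball v (1 / (n + 1 : ℝ)) ⊆ ⋃ g ∈ s, g • K := fun h =>
      h1 (mem_of_superset (Metric.ball_mem_nhds v (by positivity)) h)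
    obtain ⟨x, hx, hxs⟩ := Set.not_subset.1 h2
    obtain ⟨g, hg⟩ := exists_smul_mem hKX x
    refine ⟨g⁻¹, fun h => hxs ?_, g • x, hg, by simpa using hx⟩
    exact Set.mem_biUnion h (Set.mem_smul_set.2 ⟨g • x, hg, by simp⟩)
  choose! γ hγ x hx hd using hstep
  let S : ℕ → Finset G := fun n => Nat.rec ∅ (fun n s => insert (γ s n) s) n
  have hS (n : ℕ) : S (n + 1) = insert (γ (S n) n) (S n) := rfl
  have hmono : Monotone S := monotone_nat_of_le_succ fun n => by
    rw [hS]; exact Finset.subset_insert _ _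
  have hinj : Function.Injective fun n => γ (S n) n := by
    refine Function.Injective.of_lt_imp_ne fun m n hmn heq => ?_
    refine hγ (S n) n (hmono (Nat.succ_le_of_lt hmn) ?_)
    rw [← heq, Nat.succ_eq_add_one, hS]
    exact Finset.mem_insert_self _ _
  have hlim : Tendsto (fun n => γ (S n) n • x (S n) n) atTop (𝓝 v) := by
    rw [tendsto_iff_dist_tendsto_zero]
    exact squeeze_zero (fun _ => dist_nonneg) (fun n => (hd (S n) n).le)
      tendsto_one_div_add_atTop_nhds_zero_nat
  have hfin := hG.finite_smul_inter hK hlim.isCompact_insert_range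
  refine Set.infinite_range_of_injective hinj (hfin.subset ?_)
  rintro _ ⟨n, rfl⟩
  exact ⟨_, hx _ _, Set.mem_insert_of_mem _ ⟨n, rfl⟩⟩

open Topology in
/-- A geodesic space with a geometric action is proper. -/
theorem IsGeometricAction.properSpace {G X : Type*} [Group G] [MetricSpace X]
    [MulAction G X] (hG : IsGeometricAction G X)
    (hX : ∀ p q : X, ∃ γ : ℝ → X, IsGeodesicFromTo γ p q) : ProperSpace X := by
  have := hG.isometric
  obtain ⟨K, hK, hKX⟩ := hG.cocompact
  have : LocallyCompactSpace X := by
    have : WeaklyLocallyCompactSpace X := ⟨hG.exists_isCompact_mem_nhds⟩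
    infer_instance
  obtain ⟨L, hL, hKL⟩ := exists_compact_superset hK
  obtain ⟨ε, hε, hεL⟩ := hK.exists_thickening_subset_open isOpen_interior hKL
  have hball (x : X) : IsCompact (Metric.closedBall x (ε / 2)) := by
    obtain ⟨g, hg⟩ := exists_smul_mem hKX x
    have h1 : IsCompact (Metric.closedBall (g • x) (ε / 2)) := by
      refine hL.of_isClosed_subset Metric.isClosed_closedBall fun y hy => ?_
      refine interior_subset (hεL (Metric.mem_thickening_iff.2 ⟨_, hg, ?_⟩))
      rw [Metric.mem_closedBall] at hy
      linarith
    have h2 := h1.smul g⁻¹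
    rwa [Metric.smul_closedBall, inv_smul_smul] at h2
  -- Compact balls of one radius `ε / 2` are propagated along geodesics. Of this radius, `ε / 4`
  -- pays for the step outwards and `ε / 4` for the net in the smaller ball.
  have hn (x : X) (n : ℕ) : IsCompact (Metric.closedBall x (n * (ε / 4))) := by
    induction n with
    | zero => simp
    | succ n ih =>
      obtain ⟨t, ht, htf, hcov⟩ := ih.finite_cover_balls (show 0 < ε / 4 by positivity)
      refine (htf.isCompact_biUnion fun y _ => hball y).of_isClosed_subset
        Metric.isClosed_closedBall fun z hz => ?_
      rw [Metric.mem_closedBall, dist_comm] at hz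
      obtain ⟨γ, hγ⟩ := hX x z
      obtain ⟨y, hy1, hy2⟩ : ∃ y, dist y x ≤ n * (ε / 4) ∧ dist z y ≤ ε / 4 := by
        by_cases h : dist x z ≤ n * (ε / 4)
        · exact ⟨z, by rwa [dist_comm], by simp; positivity⟩
        · push Not at h
          have h0 : (n : ℝ) * (ε / 4) ∈ Set.Icc 0 (dist x z) := ⟨by positivity, h.le⟩
          refine ⟨γ (n * (ε / 4)), ?_, ?_⟩
          · have := hγ.dist_eq _ h0 0 ⟨le_rfl, dist_nonneg⟩
            rw [hγ.map_zero, sub_zero, abs_of_nonneg h0.1] at this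
            exact this.le
          · have := hγ.dist_eq (dist x z) ⟨dist_nonneg, le_rfl⟩ _ h0
            rw [hγ.map_dist, abs_of_nonneg (by linarith)] at this
            push_cast at hz
            linarith
      obtain ⟨u, hu, hyu⟩ := Set.mem_iUnion₂.1 (hcov (Metric.mem_closedBall.2 hy1))
      refine Set.mem_biUnion hu ?_
      rw [Metric.mem_ball] at hyu
      rw [Metric.mem_closedBall]
      linarith [dist_triangle z y u]
  refine ⟨fun x r => ?_⟩
  obtain ⟨n, hn'⟩ := exists_nat_ge (r / (ε / 4))
  refine (hn x n).of_isClosed_subset Metric.isClosed_closedBall (Metric.closedBall_subset_closedBall ?_)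
  rwa [div_le_iff₀ (by positivity)] at hn'

/-! ### Quadratic forms on ℤ². -/

section QuadraticForm

theorem int_eq_affine_of_add_eq {u : ℤ → ℝ} (h : ∀ i, u (i + 1) + u (i - 1) = 2 * u i) (i : ℤ) :
    u i = u 0 + i * (u 1 - u 0) := by
  suffices H : ∀ n : ℕ, (u n = u 0 + n * (u 1 - u 0) ∧ u (n + 1) = u 0 + (n + 1) * (u 1 - u 0)) ∧
      (u (-n) = u 0 - n * (u 1 - u 0) ∧ u (-n + 1) = u 0 - (n - 1) * (u 1 - u 0)) by
    obtain ⟨n, rfl | rfl⟩ := i.eq_nat_or_neg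
    · simpa using (H n).1.1
    · rw [(H n).2.1]; push_cast; ring
  intro n
  induction n with
  | zero => simp
  | succ n ih =>
    obtain ⟨⟨h1, h2⟩, h3, h4⟩ := ih
    have h5 := h (n + 1)
    have h6 := h (-n)
    push_cast
    rw [show (n : ℤ) + 1 - 1 = n by ring] at h5
    rw [show -((n : ℤ) + 1) = -n - 1 by ring, show -(n : ℤ) - 1 + 1 = -n by ring]
    refine ⟨⟨h2, by linarith⟩, by linarith, by linarith⟩

/-- The Jordan–von Neumann theorem for `ℤ²`. -/
theorem exists_quadratic_of_parallelogram {q : ℤ × ℤ → ℝ}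
    (hq : ∀ g h, q (g + h) + q (g - h) = 2 * (q g + q h)) :
    ∃ p c s : ℝ, ∀ i j : ℤ, q (i, j) = p * i ^ 2 + c * i * j + s * j ^ 2 := by
  refine ⟨q (1, 0), q (1, 1) - q (1, 0) - q (0, 1), q (0, 1), ?_⟩
  have h00 : q (0, 0) = 0 := by
    have := hq (0, 0) (0, 0)
    simp only [Prod.mk_add_mk, Prod.mk_sub_mk, add_zero, sub_zero] at this
    linarith
  set p := q (1, 0) with hp
  set s := q (0, 1) with hs
  set c := q (1, 1) - p - s with hc
  -- The defect from the candidate form is affine in each variable and vanishes at the four corners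
  -- of the unit square.
  set e : ℤ → ℤ → ℝ := fun i j => q (i, j) - (p * i ^ 2 + c * i * j + s * j ^ 2) with he
  have e1 (j i : ℤ) : e (i + 1) j + e (i - 1) j = 2 * e i j := by
    have := hq (i, j) (1, 0)
    simp only [Prod.mk_add_mk, Prod.mk_sub_mk, add_zero, sub_zero, ← hp] at this
    simp only [he]; push_cast; linarith
  have e2 (i j : ℤ) : e i (j + 1) + e i (j - 1) = 2 * e i j := by
    have := hq (i, j) (0, 1)
    simp only [Prod.mk_add_mk, Prod.mk_sub_mk, add_zero, sub_zero, ← hs] at this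
    simp only [he]; push_cast; linarith
  have e00 : e 0 0 = 0 := by simp [he, h00]
  have e10 : e 1 0 = 0 := by simp [he, hp]
  have e01 : e 0 1 = 0 := by simp [he, hs]
  have e11 : e 1 1 = 0 := by simp [he, hc]; ring
  intro i j
  suffices e i j = 0 by simp only [he] at this; linarith
  rw [int_eq_affine_of_add_eq (u := fun i => e i j) (e1 j) i, int_eq_affine_of_add_eq (e2 0) j,
    int_eq_affine_of_add_eq (e2 1) j, e00, e10, e01, e11]
  ring

/-- Complete the square. If the coefficient of `j ^ 2` left over were nonpositive, taking for `i`
the integer nearest to `-(c * j) / (2 * p)` would give a value at most `p` for every `j`. -/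
theorem quadratic_posDef_of_finite {p c s : ℝ}
    (hfin : ∀ R : ℝ, {g : ℤ × ℤ | p * g.1 ^ 2 + c * g.1 * g.2 + s * g.2 ^ 2 ≤ R}.Finite) :
    0 < p ∧ 0 < s - c ^ 2 / (4 * p) := by
  have hp : 0 < p := by
    by_contra! hp
    refine Set.infinite_range_of_injective (f := fun i : ℤ => (i, (0 : ℤ)))
      (fun i j h => by simpa using h) ((hfin 0).subset ?_)
    rintro _ ⟨i, rfl⟩
    simpa using mul_nonpos_of_nonpos_of_nonneg hp (sq_nonneg (i : ℝ))
  refine ⟨hp, ?_⟩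
  by_contra! hs
  refine Set.infinite_range_of_injective (f := fun j : ℤ => (round (-(c * j) / (2 * p)), j))
    (fun i j h => by simpa using congrArg Prod.snd h) ((hfin p).subset ?_)
  rintro _ ⟨j, rfl⟩
  simp only [Set.mem_ofPred_eq]
  set t : ℝ := -(c * j) / (2 * p) with ht
  have h1 := abs_sub_round t
  have h2 : (t - round t) ^ 2 ≤ (1 / 2) ^ 2 := sq_le_sq' (abs_le.1 h1).1 (abs_le.1 h1).2
  have h3 : p * (round t : ℝ) ^ 2 + c * round t * j + s * j ^ 2 =
      p * (t - round t) ^ 2 + j ^ 2 * (s - c ^ 2 / (4 * p)) := by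
    rw [ht]; field_simp; ring
  rw [h3]
  nlinarith [mul_nonneg (sq_nonneg (j : ℝ)) (neg_nonneg.2 hs)]

/-- A positive definite quadratic form on `ℤ²` is the squared norm of a lattice in the plane. -/
theorem exists_lattice_of_posDef {p c s : ℝ} (hp : 0 < p) (hs : 0 < s - c ^ 2 / (4 * p)) :
    ∃ T : ℤ × ℤ →+ EuclideanSpace ℝ (Fin 2),
      (∀ g, ‖T g‖ ^ 2 = p * g.1 ^ 2 + c * g.1 * g.2 + s * g.2 ^ 2) ∧
      ∃ C : ℝ, ∀ v, ∃ g, ‖v - T g‖ ≤ C := by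
  set α := Real.sqrt p with hα
  set σ := Real.sqrt (s - c ^ 2 / (4 * p)) with hσ
  have hα0 : 0 < α := Real.sqrt_pos.2 hp
  have hσ0 : 0 < σ := Real.sqrt_pos.2 hs
  have hα2 : α ^ 2 = p := Real.sq_sqrt hp.le
  have hσ2 : σ ^ 2 = s - c ^ 2 / (4 * p) := Real.sq_sqrt hs.le
  -- The Cholesky factor of the form. Being triangular, it lets the coordinates be rounded one after
  -- the other, the second first.
  set T : ℤ × ℤ →+ EuclideanSpace ℝ (Fin 2) :=
    { toFun := fun g => !₂[g.1 * α + g.2 * (c / (2 * α)), g.2 * σ]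
      map_zero' := by ext i; fin_cases i <;> simp
      map_add' := fun g h => by
        ext i; fin_cases i <;> simp <;> ring } with hT
  have hT0 (g : ℤ × ℤ) : T g 0 = g.1 * α + g.2 * (c / (2 * α)) := rfl
  have hT1 (g : ℤ × ℤ) : T g 1 = g.2 * σ := rfl
  refine ⟨T, fun g => ?_, Real.sqrt (α ^ 2 + σ ^ 2), fun v => ?_⟩
  · rw [EuclideanSpace.norm_sq_eq, Fin.sum_univ_two, hT0, hT1, Real.norm_eq_abs, Real.norm_eq_abs,
      sq_abs, sq_abs, mul_pow, hσ2, ← hα2]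
    field_simp
    ring
  · set j := ⌊v 1 / σ⌋ with hj
    set i := ⌊(v 0 - j * (c / (2 * α))) / α⌋ with hi
    refine ⟨(i, j), ?_⟩
    have hfl (x t : ℝ) (ht : 0 < t) : (x - ⌊x / t⌋ * t) ^ 2 ≤ t ^ 2 := by
      have h1 := Int.floor_le (x / t)
      have h2 := (Int.lt_floor_add_one (x / t)).le
      rw [le_div_iff₀ ht] at h1
      rw [div_le_iff₀ ht] at h2
      apply sq_le_sq' <;> linarith
    rw [EuclideanSpace.norm_eq, Fin.sum_univ_two, Real.norm_eq_abs, Real.norm_eq_abs, sq_abs, sq_abs]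
    refine Real.sqrt_le_sqrt (add_le_add ?_ ?_)
    · rw [PiLp.sub_apply, hT0]
      have := hfl (v 0 - j * (c / (2 * α))) α hα0
      rw [← hi] at this
      rwa [← sub_sub, sub_right_comm]
    · rw [PiLp.sub_apply, hT1]
      exact hfl (v 1) σ hσ0

/-- The inequality for `g + h` and `g - h` is the reverse of that for `g` and `h` once `N` doubles
on both. On the axes it does; the resulting parallelogram laws at `(i, 0)`, `(0, j)` and at their
doubles leave no slack in the subadditive bounds for `(i, j)` and `(i, -j)`, so `N` doubles
everywhere. -/
theorem parallelogram_of_doubling {N : ℤ × ℤ → ℝ} (h0 : ∀ g, 0 ≤ N g)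
    (hadd : ∀ g h, N (g + h) ≤ N g + N h)
    (hquad : ∀ g h, N (g + h) ^ 2 + N (g - h) ^ 2 ≤ 2 * (N g ^ 2 + N h ^ 2))
    (h1 : ∀ i, N (i + i, 0) = 2 * N (i, 0)) (h2 : ∀ j, N (0, j + j) = 2 * N (0, j))
    (g h : ℤ × ℤ) : N (g + h) ^ 2 + N (g - h) ^ 2 = 2 * (N g ^ 2 + N h ^ 2) := by
  have of_dbl (g h : ℤ × ℤ) (hg : N (g + g) = 2 * N g) (hh : N (h + h) = 2 * N h) :
      N (g + h) ^ 2 + N (g - h) ^ 2 = 2 * (N g ^ 2 + N h ^ 2) := by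
    refine le_antisymm (hquad g h) ?_
    have := hquad (g + h) (g - h)
    rw [show g + h + (g - h) = g + g by abel, show g + h - (g - h) = h + h by abel, hg, hh] at this
    linarith
  have dbl (g : ℤ × ℤ) : N (g + g) = 2 * N g := by
    obtain ⟨i, j⟩ := g
    have e1 := of_dbl (i, 0) (0, j) (by simpa using h1 i) (by simpa using h2 j)
    have e2 := of_dbl (i + i, 0) (0, j + j) (by simp [h1])
      (by simp [h2])
    rw [h1, h2] at e2
    have e3 := hadd ((i, 0) + (0, j)) ((i, 0) + (0, j))
    have e4 := hadd ((i, 0) - (0, j)) ((i, 0) - (0, j))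
    simp only [Prod.mk_add_mk, Prod.mk_sub_mk, add_zero, sub_zero, zero_add, zero_sub, ← neg_add]
      at e1 e2 e3 e4
    simp only [Prod.mk_add_mk]
    refine le_antisymm (by linarith) ?_
    have a1 := h0 (i + i, j + j)
    have a4 := h0 (i + i, -(j + j))
    have e4' : N (i + i, -(j + j)) ^ 2 ≤ (2 * N (i, -j)) ^ 2 := by gcongr; linarith
    exact abs_le_of_sq_le_sq' (by linarith) a1 |>.2
  exact of_dbl g h (dbl g) (dbl h)

end QuadraticForm

/-! ### Flat planes from orbits of commuting elements. -/

section Plane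

variable {G X : Type*} [Group G] [MetricSpace X] [MulAction G X] [IsIsometricSMul G X]

/-- If `a` and `b` translate `x` along lines, then the `⟨a, b⟩`-orbit of `x` lies in a flat
plane. -/
theorem exists_isometry_plane_of_doubling [ProperSpace X]
    (hX : ∀ y z : X, ∃ m, IsCNMidpoint m y z) {a b : G} (hab : Commute a b) (x : X)
    (hfin : ∀ R : ℝ, {g : ℤ × ℤ | dist x ((a ^ g.1 * b ^ g.2) • x) ≤ R}.Finite)
    (ha : ∀ i : ℤ, dist x (a ^ (i + i) • x) = 2 * dist x (a ^ i • x))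
    (hb : ∀ j : ℤ, dist x (b ^ (j + j) • x) = 2 * dist x (b ^ j • x)) :
    ∃ f : EuclideanSpace ℝ (Fin 2) → X, Isometry f ∧
      ∀ i j : ℤ, (a ^ i * b ^ j) • x ∈ Set.range f := by
  set ρ : ℤ × ℤ → G := fun g => a ^ g.1 * b ^ g.2 with hρ
  have hρadd (g h : ℤ × ℤ) : ρ (g + h) = ρ g * ρ h := by
    have h1 : Commute (a ^ h.1) (b ^ g.2) := (hab.zpow_zpow _ _)
    simp only [hρ, Prod.fst_add, Prod.snd_add, zpow_add]
    rw [mul_assoc, ← mul_assoc (a ^ h.1), h1.eq]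
    simp only [mul_assoc]
  set N : ℤ × ℤ → ℝ := fun g => dist x (ρ g • x) with hN
  have hdist (g h : ℤ × ℤ) : dist (ρ g • x) (ρ (g + h) • x) = N h := by
    rw [hρadd, mul_smul (ρ g), dist_smul]
  have hneg (g : ℤ × ℤ) : N (-g) = N g := by
    have h1 := hdist g (-g)
    rw [add_neg_cancel, dist_comm] at h1
    rw [← h1]
    simp [hN, hρ]
  have hpar := parallelogram_of_doubling (N := N) (fun _ => dist_nonneg)
    (fun g h => (dist_triangle x (ρ g • x) _).trans (by rw [hdist]))
    (fun g h => by
      have := dist_sq_add_dist_sq_le hX x (ρ g • x) (ρ (g + h) • x) (ρ h • x)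
      rw [hdist, dist_comm (ρ (g + h) • x), add_comm g h, hdist, dist_comm (ρ h • x) x,
        show ρ g • x = ρ (h + (g - h)) • x by congr 2; abel, dist_comm _ (ρ h • x), hdist,
        show h + (g - h) = g by abel] at this
      rw [add_comm g h]
      change N (h + g) ^ 2 + N (g - h) ^ 2 ≤ N g ^ 2 + N h ^ 2 + N g ^ 2 + N h ^ 2 at this
      linarith)
    (fun i => by simpa [hN, hρ] using ha i) (fun j => by simpa [hN, hρ] using hb j)
  obtain ⟨p, c, s, hq⟩ := exists_quadratic_of_parallelogram (q := fun g => N g ^ 2) hpar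
  obtain ⟨hp, hs⟩ := quadratic_posDef_of_finite (p := p) (c := c) (s := s) fun R => by
    refine (hfin (Real.sqrt R)).subset fun g hg => ?_
    rw [Set.mem_ofPred_eq, ← hq] at hg
    exact Real.le_sqrt_of_sq_le hg
  obtain ⟨T, hT, C, hC⟩ := exists_lattice_of_posDef hp hs
  have hTN (g : ℤ × ℤ) : ‖T g‖ = N g := by
    rw [← sq_eq_sq₀ (norm_nonneg _) dist_nonneg, hT, ← hq]
  have hTd (g h : ℤ × ℤ) : dist (ρ g • x) (ρ h • x) = ‖T g - T h‖ := by
    rw [← map_sub, hTN, ← hneg, ← hdist g]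
    congr 3; abel
  -- By `hTd` the orbit point depends only on the value of `T`, so the choice of preimage is
  -- harmless; values off the range of `T` are never used.
  set f : EuclideanSpace ℝ (Fin 2) → X := fun v => ρ (Function.invFun T v) • x with hf
  have hfT (g : ℤ × ℤ) : f (T g) = ρ g • x := by
    rw [← dist_eq_zero, hf, hTd, Function.invFun_eq (f := T) ⟨g, rfl⟩, sub_self, norm_zero]
  obtain ⟨f', hf', hff'⟩ := exists_isometry_extending hX T.range (C := C)
    (fun v => by obtain ⟨g, hg⟩ := hC v; exact ⟨T g, ⟨g, rfl⟩, hg⟩) f (by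
      rintro _ ⟨g, rfl⟩ _ ⟨h, rfl⟩
      rw [hfT, hfT, hTd])
  refine ⟨f', hf', fun i j => ⟨T (i, j), ?_⟩⟩
  rw [hff' _ ⟨_, rfl⟩, hfT]

end Plane

/-! ### Minimal displacement and the flat torus theorem. -/

section Minimizer

variable {G X : Type*} [Group G] [MetricSpace X] [MulAction G X]

/-- In a geometric action, the sum of the squared displacements of two elements has a minimum. -/
theorem IsGeometricAction.exists_min_displacement [Nonempty X] [ProperSpace X]
    (hG : IsGeometricAction G X) (a b : G) :
    ∃ x : X, ∀ y : X, dist x (a • x) ^ 2 + dist x (b • x) ^ 2 ≤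
      dist y (a • y) ^ 2 + dist y (b • y) ^ 2 := by
  have := hG.isometric
  obtain ⟨K, hK, hKX⟩ := hG.cocompact
  obtain ⟨x₁⟩ := ‹Nonempty X›
  set E : G × G → X → ℝ := fun c y => dist y (c.1 • y) ^ 2 + dist y (c.2 • y) ^ 2 with hE
  have hEcont (c : G × G) : Continuous (E c) := by
    have h1 := (isometry_smul X c.1).continuous
    have h2 := (isometry_smul X c.2).continuous
    fun_prop
  set conj : G → G × G := fun g => (g * a * g⁻¹, g * b * g⁻¹) with hconj
  have hEconj (g : G) (y : X) : E (conj g) (g • y) = E (a, b) y := by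
    simp only [hE, hconj, mul_smul, inv_smul_smul, dist_smul]
  set R := E (a, b) x₁ + 1 with hR
  have hR1 : 1 ≤ R := by
    have : 0 ≤ E (a, b) x₁ := by simp only [hE]; positivity
    linarith
  set S : Set G := {g | ∃ x ∈ K, g • x ∈ Metric.cthickening R K} with hS
  have hSfin : S.Finite := hG.finite_smul_inter hK hK.cthickening
  -- Moving a point into `K` conjugates the pair `(a, b)`. Bounded displacement leaves only finitely
  -- many conjugate pairs, and for each of them the energy has a minimum on `K`.
  set P : Set (G × G) := Set.range conj ∩ S ×ˢ S with hP
  have hPfin : P.Finite := (hSfin.prod hSfin).subset Set.inter_subset_right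
  have hmem (y : X) (hy : E (a, b) y ≤ E (a, b) x₁) (g : G) (hg : g • y ∈ K) : conj g ∈ P := by
    have key (c : G) (hc : dist y (c • y) ^ 2 ≤ E (a, b) x₁) : g * c * g⁻¹ ∈ S := by
      refine ⟨g • y, hg, Metric.mem_cthickening_of_dist_le _ (g • y) _ _ hg ?_⟩
      rw [mul_smul, inv_smul_smul, mul_smul, dist_smul, dist_comm]
      nlinarith [sq_nonneg (dist y (c • y) - 1)]
    refine ⟨⟨g, rfl⟩, key a ?_, key b ?_⟩
    · exact le_trans (le_add_of_nonneg_right (sq_nonneg _)) hy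
    · exact le_trans (le_add_of_nonneg_left (sq_nonneg _)) hy
  obtain ⟨g₁, hg₁⟩ := exists_smul_mem hKX x₁
  have hKne : K.Nonempty := ⟨_, hg₁⟩
  choose y hyK hy using fun c => hK.exists_isMinOn hKne (hEcont c).continuousOn
  obtain ⟨c, hcP, hc⟩ := Set.exists_min_image P (fun c => E c (y c)) hPfin ⟨_, hmem x₁ le_rfl g₁ hg₁⟩
  obtain ⟨⟨g, rfl⟩, -⟩ := hcP
  have hle (z : X) (hz : E (a, b) z ≤ E (a, b) x₁) :
      E (a, b) (g⁻¹ • y (conj g)) ≤ E (a, b) z := by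
    obtain ⟨h, hh⟩ := exists_smul_mem hKX z
    rw [← hEconj g, smul_inv_smul, ← hEconj h]
    exact (hc _ (hmem z hz h hh)).trans (hy (conj h) hh)
  refine ⟨g⁻¹ • y (conj g), fun z => ?_⟩
  rcases le_total (E (a, b) z) (E (a, b) x₁) with hz | hz
  · exact hle z hz
  · exact (hle x₁ le_rfl).trans hz

variable [IsIsometricSMul G X]

/-- The triangle inequality bounds every power from above; a strict inequality at `n` would make the
power `2 ^ n ≥ n` too short. -/
theorem dist_zpow_smul_eq {a : G} {x : X}
    (h : ∀ k : ℕ, 2 ^ k * dist x (a • x) ≤ dist x (a ^ 2 ^ k • x)) (i : ℤ) :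
    dist x (a ^ i • x) = |(i : ℝ)| * dist x (a • x) := by
  have hle (n : ℕ) : dist x (a ^ n • x) ≤ n * dist x (a • x) := by
    induction n with
    | zero => simp
    | succ n ih =>
      have := dist_triangle x (a ^ n • x) (a ^ (n + 1) • x)
      rw [pow_succ, mul_smul, dist_smul] at this
      rw [pow_succ, mul_smul]
      push_cast; linarith
  have heq (n : ℕ) : dist x (a ^ n • x) = n * dist x (a • x) := by
    refine le_antisymm (hle n) ?_
    have h1 : n ≤ 2 ^ n := Nat.lt_two_pow_self.le
    have h2 := dist_triangle x (a ^ n • x) (a ^ 2 ^ n • x)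
    rw [← Nat.add_sub_of_le h1, pow_add, mul_smul, dist_smul, ← mul_smul, ← pow_add,
      Nat.add_sub_of_le h1] at h2
    have h3 := hle (2 ^ n - n)
    rw [Nat.cast_sub h1] at h3
    push_cast at h3
    linarith [h n]
  obtain ⟨n, rfl | rfl⟩ := i.eq_nat_or_neg
  · simpa using heq n
  · rw [← dist_smul (a ^ n)]
    simpa [dist_comm] using heq n

/-- Take the midpoint of `y` and `a • y`. The midline inequality halves the displacement of `a ^ 2`;
since `b` commutes with `a`, it displaces both endpoints equally, and convexity bounds its
displacement of the midpoint. -/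
theorem exists_dist_sq_smul_le (hX : ∀ y z : X, ∃ m, IsCNMidpoint m y z) {a b : G}
    (hab : Commute a b) (y : X) :
    ∃ m : X, dist m (a • m) ≤ dist y (a ^ 2 • y) / 2 ∧ dist m (b • m) ≤ dist y (b • y) := by
  obtain ⟨m, hm⟩ := hX y (a • y)
  refine ⟨m, ?_, ?_⟩
  · have := hm.dist_midline_le (hm.smul a)
    rwa [smul_smul, ← sq] at this
  · have := hm.dist_sq_le hX (hm.smul b)
    rw [smul_smul, ← hab.eq, mul_smul, dist_smul] at this
    exact abs_le_of_sq_le_sq' (by linarith) dist_nonneg |>.2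

/-- Passing to midpoints `k` times trades the displacement of `a ^ 2 ^ k` for `2 ^ k` times that of
`a` without increasing that of `b`. Starting from the minimizer itself, the `b` terms cancel, so
minimizing the sum controls each element separately. -/
theorem dist_pow_le_of_min (hX : ∀ y z : X, ∃ m, IsCNMidpoint m y z) {a b : G}
    (hab : Commute a b) {x : X} (hx : ∀ y : X, dist x (a • x) ^ 2 + dist x (b • x) ^ 2 ≤
      dist y (a • y) ^ 2 + dist y (b • y) ^ 2) (k : ℕ) :
    2 ^ k * dist x (a • x) ≤ dist x (a ^ 2 ^ k • x) := by
  have key (y : X) : dist x (a • x) ^ 2 + dist x (b • x) ^ 2 ≤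
      (dist y (a ^ 2 ^ k • y) / 2 ^ k) ^ 2 + dist y (b • y) ^ 2 := by
    induction k generalizing y with
    | zero => simpa using hx y
    | succ k ih =>
      obtain ⟨m, h1, h2⟩ := exists_dist_sq_smul_le hX (hab.pow_left (2 ^ k)) y
      refine (ih m).trans ?_
      rw [pow_succ 2 k, pow_mul, pow_succ (2 : ℝ) k, mul_comm ((2 : ℝ) ^ k), ← div_div]
      gcongr
  have h1 : dist x (a • x) ^ 2 ≤ (dist x (a ^ 2 ^ k • x) / 2 ^ k) ^ 2 := by linarith [key x]
  have h2 := abs_le_of_sq_le_sq' h1 (by positivity) |>.2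
  rw [le_div_iff₀ (by positivity)] at h2
  linarith

/-- A form of the flat torus theorem: some orbit of a free abelian group of rank two that acts
geometrically on a CAT(0) space lies in a flat plane. -/
theorem exists_isometry_plane_of_commute [Nonempty X] [ProperSpace X]
    (hX : ∀ y z : X, ∃ m, IsCNMidpoint m y z) (hG : IsGeometricAction G X) {a b : G}
    (hab : Commute a b) (hinj : Function.Injective fun g : ℤ × ℤ => a ^ g.1 * b ^ g.2) :
    ∃ (x : X) (f : EuclideanSpace ℝ (Fin 2) → X), Isometry f ∧
      ∀ i j : ℤ, (a ^ i * b ^ j) • x ∈ Set.range f := by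
  obtain ⟨x, hx⟩ := hG.exists_min_displacement a b
  have ha := dist_zpow_smul_eq (dist_pow_le_of_min hX hab hx)
  have hb := dist_zpow_smul_eq (dist_pow_le_of_min hX hab.symm fun y => by linarith [hx y])
  refine ⟨x, exists_isometry_plane_of_doubling hX hab x (fun R => ?_) (fun i => ?_) (fun j => ?_)⟩
  · refine Set.Finite.of_finite_image (f := fun g : ℤ × ℤ => a ^ g.1 * b ^ g.2)
      ((hG.finite_smul_inter (isCompact_singleton (x := x))
        (isCompact_closedBall x R)).subset ?_) hinj.injOn
    rintro _ ⟨g, hg, rfl⟩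
    exact ⟨x, rfl, by rwa [Metric.mem_closedBall, dist_comm]⟩
  · rw [ha, ha, ← two_mul]; push_cast; rw [abs_mul, abs_two]; ring
  · rw [hb, hb, ← two_mul]; push_cast; rw [abs_mul, abs_two]; ring

end Minimizer

/-! ### Bieberbach's theorem: commutators and small rotations. -/

open scoped commutatorElement

theorem eq_zero_of_nat_mul_norm_le {V : Type*} [NormedAddCommGroup V] {v : V} {C : ℝ} (h : ∀ n : ℕ, n * ‖v‖ ≤ C) : v = 0 := by
  by_contra hv
  have hv' : 0 < ‖v‖ := norm_pos_iff.2 hv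
  obtain ⟨n, hn⟩ := exists_nat_gt (C / ‖v‖)
  rw [div_lt_iff₀ hv'] at hn
  linarith [h n]

section Linear

variable {V : Type*} [NormedAddCommGroup V] [NormedSpace ℝ V]

/-- There are no small subgroups near the identity. -/
theorem ContinuousLinearMap.eq_one_of_forall_norm_pow_sub_one_le {D : V →L[ℝ] V}
    (hD : ∀ n : ℕ, ‖D ^ n - 1‖ ≤ 1 / 2) : D = 1 := by
  refine sub_eq_zero.1 (ContinuousLinearMap.ext fun v => ?_)
  -- Since `E ^ 2 - 1 = (E - 1) ^ 2 + 2 * (E - 1)` and `‖E - 1‖ ≤ 1 / 2`, each squaring expands by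
  -- at least `2 - 1 / 2`.
  have key (k : ℕ) : (3 / 2) ^ k * ‖(D - 1) v‖ ≤ ‖(D ^ 2 ^ k - 1 : V →L[ℝ] V) v‖ := by
    induction k with
    | zero => simp
    | succ k ih =>
      set E := D ^ 2 ^ k with hE
      set u := (E - 1) v with hu
      have h1 : (D ^ 2 ^ (k + 1) - 1 : V →L[ℝ] V) v = (E - 1) u + (2 : ℝ) • u := by
        rw [pow_succ, pow_mul, ← hE, hu, ← mul_apply_eq_comp,
          ← smul_apply, ← add_apply]
        congr 1
        rw [two_smul]; noncomm_ring
      have h2 : ‖(E - 1) u‖ ≤ 1 / 2 * ‖u‖ := (E - 1).le_of_opNorm_le (hD _) u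
      have h3 : ‖(2 : ℝ) • u‖ ≤ ‖(E - 1) u + (2 : ℝ) • u‖ + ‖(E - 1) u‖ := by
        have := norm_sub_le ((E - 1) u + (2 : ℝ) • u) ((E - 1) u)
        rwa [add_sub_cancel_left] at this
      rw [norm_smul, Real.norm_ofNat] at h3
      rw [h1, pow_succ]
      linarith
  refine eq_zero_of_nat_mul_norm_le (C := 2 * (1 / 2 * ‖v‖)) fun n => ?_
  have h1 : (n : ℝ) ≤ 2 * (3 / 2) ^ n := by
    have := one_add_mul_le_pow (a := (1 / 2 : ℝ)) (by norm_num) n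
    norm_num at this
    linarith
  have h2 : ‖(D ^ 2 ^ n - 1 : V →L[ℝ] V) v‖ ≤ 1 / 2 * ‖v‖ := (D ^ 2 ^ n - 1).le_of_opNorm_le (hD _) v
  calc n * ‖(D - 1) v‖ ≤ 2 * (3 / 2) ^ n * ‖(D - 1) v‖ := by gcongr
    _ ≤ 2 * (1 / 2 * ‖v‖) := by linarith [key n]

/-- Under the hypothesis `(A ^ n) v = v + n • (A v - v)`, which stays bounded for an isometry only
if `A v = v`. -/
theorem ContinuousLinearMap.apply_eq_of_apply_sub_eq {A : V →L[ℝ] V} (hA : ∀ v, ‖A v‖ = ‖v‖) {v : V}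
    (h : A (A v - v) = A v - v) : A v = v := by
  refine sub_eq_zero.1 (eq_zero_of_nat_mul_norm_le (C := 2 * ‖v‖) fun n => ?_)
  have h1 : (A ^ n) v = v + (n : ℝ) • (A v - v) := by
    induction n with
    | zero => simp
    | succ n ih =>
      rw [pow_succ', mul_apply_eq_comp, ih, map_add, map_smul, h]
      push_cast; rw [add_smul, one_smul]; abel
  have h2 : ‖(A ^ n) v‖ = ‖v‖ := by
    clear h1
    induction n with
    | zero => simp
    | succ n ih => rw [pow_succ', mul_apply_eq_comp, hA, ih]
  have h3 : (n : ℝ) • (A v - v) = (A ^ n) v - v := by rw [h1]; abel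
  calc n * ‖A v - v‖ = ‖(n : ℝ) • (A v - v)‖ := by rw [norm_smul]; simp
    _ ≤ 2 * ‖v‖ := by rw [h3]; linarith [norm_sub_le ((A ^ n) v) v]

end Linear

/-- An isometric action of `Γ` on `V`, in which `g` acts as `v ↦ rot g v + trans g`. -/
structure EuclideanAction (Γ V : Type*) [Group Γ] [NormedAddCommGroup V] [NormedSpace ℝ V] where
  rot : Γ →* (V →L[ℝ] V)
  trans : Γ → V
  norm_rot : ∀ g v, ‖rot g v‖ = ‖v‖
  trans_mul : ∀ g h, trans (g * h) = trans g + rot g (trans h)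

namespace EuclideanAction

variable {Γ V : Type*} [Group Γ] [NormedAddCommGroup V] [NormedSpace ℝ V]
  (ρ : EuclideanAction Γ V)

theorem trans_one : ρ.trans 1 = 0 := by
  have := ρ.trans_mul 1 1
  simpa using this

theorem trans_inv (g : Γ) : ρ.trans g⁻¹ = -ρ.rot g⁻¹ (ρ.trans g) := by
  have := ρ.trans_mul g⁻¹ g
  rw [inv_mul_cancel, trans_one] at this
  exact eq_neg_of_add_eq_zero_left this.symm

theorem norm_trans_inv (g : Γ) : ‖ρ.trans g⁻¹‖ = ‖ρ.trans g‖ := by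
  rw [trans_inv, norm_neg, norm_rot]

theorem norm_rot_le (g : Γ) : ‖ρ.rot g‖ ≤ 1 :=
  ContinuousLinearMap.opNorm_le_bound _ zero_le_one fun v => by rw [norm_rot, one_mul]

theorem norm_mul_rot_le (B : V →L[ℝ] V) (g : Γ) : ‖B * ρ.rot g‖ ≤ ‖B‖ :=
  (norm_mul_le _ _).trans (mul_le_of_le_one_right (norm_nonneg _) (ρ.norm_rot_le g))

theorem norm_rot_mul_le (B : V →L[ℝ] V) (g : Γ) : ‖ρ.rot g * B‖ ≤ ‖B‖ :=
  (norm_mul_le _ _).trans (mul_le_of_le_one_left (norm_nonneg _) (ρ.norm_rot_le g))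

theorem norm_rot_sub_one_le (g : Γ) : ‖ρ.rot g - 1‖ ≤ 2 := by
  have h1 := norm_sub_le (ρ.rot g) (ρ.rot 1)
  rw [map_one ρ.rot] at h1
  have h2 := ρ.norm_rot_le g
  have h3 := ρ.norm_rot_le 1
  rw [map_one] at h3
  linarith

theorem norm_rot_mul_inv_sub_one_le (g h : Γ) :
    ‖ρ.rot (g * h⁻¹) - 1‖ ≤ ‖ρ.rot g - ρ.rot h‖ := by
  have h1 : ρ.rot (g * h⁻¹) - 1 = (ρ.rot g - ρ.rot h) * ρ.rot h⁻¹ := by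
    rw [sub_mul, ← map_mul, ← map_mul, mul_inv_cancel, map_one]
  rw [h1]
  exact ρ.norm_mul_rot_le _ _

theorem norm_rot_inv_sub_one_le (g : Γ) : ‖ρ.rot g⁻¹ - 1‖ ≤ ‖ρ.rot g - 1‖ := by
  have := ρ.norm_rot_mul_inv_sub_one_le 1 g
  rwa [one_mul, map_one ρ.rot, norm_sub_rev 1] at this

theorem norm_rot_commutator_sub_one_le (g h : Γ) :
    ‖ρ.rot ⁅g, h⁆ - 1‖ ≤ 2 * (‖ρ.rot g - 1‖ * ‖ρ.rot h - 1‖) := by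
  have h1 := ρ.norm_rot_mul_inv_sub_one_le (g * h) (h * g)
  rw [mul_inv_rev, ← mul_assoc, ← commutatorElement_def, map_mul, map_mul] at h1
  have h2 : ρ.rot g * ρ.rot h - ρ.rot h * ρ.rot g =
      (ρ.rot g - 1) * (ρ.rot h - 1) - (ρ.rot h - 1) * (ρ.rot g - 1) := by noncomm_ring
  rw [h2] at h1
  have h3 := norm_sub_le ((ρ.rot g - 1) * (ρ.rot h - 1)) ((ρ.rot h - 1) * (ρ.rot g - 1))
  have h4 := norm_mul_le (ρ.rot g - 1) (ρ.rot h - 1)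
  have h5 := norm_mul_le (ρ.rot h - 1) (ρ.rot g - 1)
  linarith

/-- Expanding the commutator, the coefficient of `trans h` is conjugate-small with `rot g - 1` and
that of `trans g` with `rot h - 1`. Together with the quadratic bound for rotations, this makes
iterated commutators contract. -/
theorem norm_trans_commutator_le (g h : Γ) :
    ‖ρ.trans ⁅g, h⁆‖ ≤ ‖ρ.rot g - 1‖ * ‖ρ.trans h‖ + ‖ρ.rot h - 1‖ * ‖ρ.trans g‖ := by
  have h1 : ρ.trans ⁅g, h⁆ = (ρ.trans (g * h) - ρ.trans (h * g)) -
      (ρ.rot ⁅g, h⁆ - 1) (ρ.trans (h * g)) := by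
    have : g * h = ⁅g, h⁆ * (h * g) := by rw [commutatorElement_def]; group
    conv_rhs => rw [this, trans_mul]
    rw [sub_apply, one_apply_eq_self]
    abel
  have h2 : ρ.trans ⁅g, h⁆ = ρ.trans g + ρ.rot g (ρ.trans h)
      - ρ.rot (g * h * g⁻¹) (ρ.trans g) - ρ.rot ⁅g, h⁆ (ρ.trans h) := by
    have e : ρ.rot (g * h * g⁻¹) = ρ.rot ⁅g, h⁆ * ρ.rot h := by
      rw [← map_mul, commutatorElement_def]; congr 1; group
    rw [h1, trans_mul, trans_mul, e]
    simp only [sub_apply, one_apply_eq_self, map_add,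
      mul_apply_eq_comp]
    abel
  have h3 : ρ.trans ⁅g, h⁆ = (ρ.rot g - ρ.rot ⁅g, h⁆) (ρ.trans h) -
      (ρ.rot (g * h * g⁻¹) - 1) (ρ.trans g) := by
    rw [h2]
    simp only [sub_apply, one_apply_eq_self]
    abel
  have h4 : ‖ρ.rot g - ρ.rot ⁅g, h⁆‖ ≤ ‖ρ.rot g - 1‖ := by
    have : ρ.rot g - ρ.rot ⁅g, h⁆ = ρ.rot (g * h) * ((1 - ρ.rot g⁻¹) * ρ.rot h⁻¹) := by
      rw [sub_mul, mul_sub, one_mul, ← map_mul, ← map_mul, ← map_mul, mul_inv_cancel_right,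
        commutatorElement_def, mul_assoc (g * h)]
    rw [this]
    refine (ρ.norm_rot_mul_le _ _).trans ((ρ.norm_mul_rot_le _ _).trans ?_)
    rw [norm_sub_rev]
    exact ρ.norm_rot_inv_sub_one_le g
  have h5 : ‖ρ.rot (g * h * g⁻¹) - 1‖ ≤ ‖ρ.rot h - 1‖ := by
    have : ρ.rot (g * h * g⁻¹) - 1 = ρ.rot g * ((ρ.rot h - 1) * ρ.rot g⁻¹) := by
      rw [sub_mul, mul_sub, one_mul, ← map_mul, ← map_mul, ← map_mul, mul_inv_cancel, map_one,
        mul_assoc]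
    rw [this]
    exact (ρ.norm_rot_mul_le _ _).trans (ρ.norm_mul_rot_le _ _)
  rw [h3]
  refine (norm_sub_le _ _).trans (add_le_add ?_ ?_)
  · exact ContinuousLinearMap.le_of_opNorm_le _ h4 _
  · exact ContinuousLinearMap.le_of_opNorm_le _ h5 _

end EuclideanAction

namespace EuclideanAction

section

variable {Γ V : Type*} [Group Γ] [NormedAddCommGroup V] [NormedSpace ℝ V]
  (ρ : EuclideanAction Γ V)

/-- If a rotation commutes with its commutator with a small rotation, then the two commute. -/
theorem rot_commutator_eq_one {g h : Γ} (hg : ‖ρ.rot g - 1‖ ≤ 1 / 8)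
    (hc : Commute (ρ.rot ⁅g, h⁆) (ρ.rot h)) : ρ.rot ⁅g, h⁆ = 1 := by
  refine ContinuousLinearMap.eq_one_of_forall_norm_pow_sub_one_le fun n => ?_
  -- The commutation hypothesis gives `⁅g, h⁆ ^ n * h ^ n = (g * h * g⁻¹) ^ n` on rotations. All
  -- powers are thus commutators with `g`, within `2 * (1 / 8 * 2) = 1 / 2` of the identity.
  have h1 : ρ.rot ⁅g, h⁆ ^ n = ρ.rot ⁅g, h ^ n⁆ := by
    have e1 : ρ.rot ⁅g, h⁆ ^ n * ρ.rot h ^ n = ρ.rot ⁅g, h ^ n⁆ * ρ.rot h ^ n := by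
      rw [← hc.mul_pow, ← map_mul, ← map_pow, ← map_pow, ← map_mul, commutatorElement_def,
        commutatorElement_def, inv_mul_cancel_right, inv_mul_cancel_right, conj_pow]
    have e2 : ρ.rot h ^ n * ρ.rot (h ^ n)⁻¹ = 1 := by
      rw [← map_pow, ← map_mul, mul_inv_cancel, map_one]
    simpa only [mul_assoc, e2, mul_one] using congrArg (· * ρ.rot (h ^ n)⁻¹) e1
  rw [h1]
  have h2 := ρ.norm_rot_commutator_sub_one_le g (h ^ n)
  have h3 := ρ.norm_rot_sub_one_le (h ^ n)
  have h4 : ‖ρ.rot g - 1‖ * ‖ρ.rot (h ^ n) - 1‖ ≤ 1 / 8 * 2 := by gcongr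
  linarith

/-- The iterated commutators `⁅…⁅⁅g, h⁆, h⁆…, h⁆`. -/
def iterComm (g h : Γ) : ℕ → Γ
  | 0 => g
  | n + 1 => ⁅iterComm g h n, h⁆

theorem norm_rot_iterComm_le {g h : Γ} (hg : ‖ρ.rot g - 1‖ ≤ 1 / 8) (hh : ‖ρ.rot h - 1‖ ≤ 1 / 8)
    (n : ℕ) : ‖ρ.rot (iterComm g h n) - 1‖ ≤ 1 / 8 * (1 / 2) ^ n := by
  induction n with
  | zero => simpa [iterComm] using hg
  | succ n ih =>
    refine (ρ.norm_rot_commutator_sub_one_le _ _).trans ?_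
    have : ‖ρ.rot (iterComm g h n) - 1‖ * ‖ρ.rot h - 1‖ ≤ 1 / 8 * (1 / 2) ^ n * (1 / 8) := by gcongr
    rw [pow_succ]
    nlinarith [pow_pos (show (0 : ℝ) < 1 / 2 by norm_num) n]

theorem norm_trans_iterComm_le {g h : Γ} (hg : ‖ρ.rot g - 1‖ ≤ 1 / 8) (hh : ‖ρ.rot h - 1‖ ≤ 1 / 8)
    (n : ℕ) : ‖ρ.trans (iterComm g h n)‖ ≤ (‖ρ.trans g‖ + ‖ρ.trans h‖) * (1 / 2) ^ n := by
  induction n with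
  | zero => simp [iterComm]
  | succ n ih =>
    refine (ρ.norm_trans_commutator_le _ _).trans ?_
    have h1 : ‖ρ.rot (iterComm g h n) - 1‖ * ‖ρ.trans h‖ ≤ 1 / 8 * (1 / 2) ^ n * ‖ρ.trans h‖ := by
      gcongr; exact ρ.norm_rot_iterComm_le hg hh n
    have h2 : ‖ρ.rot h - 1‖ * ‖ρ.trans (iterComm g h n)‖ ≤
        1 / 8 * ((‖ρ.trans g‖ + ‖ρ.trans h‖) * (1 / 2) ^ n) := by gcongr
    rw [pow_succ]
    have h3 := mul_nonneg (norm_nonneg (ρ.trans g)) (pow_nonneg (show (0 : ℝ) ≤ 1 / 2 by norm_num) n)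
    have h4 := mul_nonneg (norm_nonneg (ρ.trans h)) (pow_nonneg (show (0 : ℝ) ≤ 1 / 2 by norm_num) n)
    linarith

open Filter Topology in
-- The iterated commutators tend to the identity but have bounded translation parts, so they take
-- finitely many values; eventually they act trivially, though they may be nontrivial in the kernel.
theorem eventually_iterComm (hfin : ∀ R : ℝ, {g | ‖ρ.trans g‖ ≤ R}.Finite) {g h : Γ}
    (hg : ‖ρ.rot g - 1‖ ≤ 1 / 8) (hh : ‖ρ.rot h - 1‖ ≤ 1 / 8) :
    ∃ N, ∀ n ≥ N, ρ.rot (iterComm g h n) = 1 ∧ ρ.trans (iterComm g h n) = 0 := by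
  set φ : Γ → ℝ := fun g => ‖ρ.rot g - 1‖ + ‖ρ.trans g‖ with hφ
  set M := ‖ρ.trans g‖ + ‖ρ.trans h‖ with hM
  have hpow : Tendsto (fun n : ℕ => (1 / 2 : ℝ) ^ n) atTop (𝓝 0) :=
    tendsto_pow_atTop_nhds_zero_of_lt_one (by norm_num) (by norm_num)
  have hlim : Tendsto (fun n => φ (iterComm g h n)) atTop (𝓝 0) := by
    refine squeeze_zero (fun n => by positivity) (fun n => add_le_add
      (ρ.norm_rot_iterComm_le hg hh n) (ρ.norm_trans_iterComm_le hg hh n)) ?_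
    have := (hpow.const_mul (1 / 8)).add (hpow.const_mul M)
    rwa [mul_zero, mul_zero, add_zero] at this
  have hS : ((φ '' {g | ‖ρ.trans g‖ ≤ M}) \ {0}).Finite := ((hfin M).image φ).sdiff
  have h0 : ((φ '' {g | ‖ρ.trans g‖ ≤ M}) \ {0})ᶜ ∈ 𝓝 (0 : ℝ) :=
    hS.isClosed.isOpen_compl.mem_nhds (by simp)
  obtain ⟨N, hN⟩ := eventually_atTop.1 (hlim.eventually h0)
  refine ⟨N, fun n hn => ?_⟩
  have h1 : φ (iterComm g h n) = 0 := by
    by_contra hne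
    refine hN n hn ⟨⟨_, ?_, rfl⟩, hne⟩
    refine (ρ.norm_trans_iterComm_le hg hh n).trans (mul_le_of_le_one_right (by positivity) ?_)
    exact pow_le_one₀ (by norm_num) (by norm_num)
  have h2 : ‖ρ.rot (iterComm g h n) - 1‖ = 0 := by
    linarith [norm_nonneg (ρ.rot (iterComm g h n) - 1), norm_nonneg (ρ.trans (iterComm g h n))]
  have h3 : ‖ρ.trans (iterComm g h n)‖ = 0 := by
    linarith [norm_nonneg (ρ.rot (iterComm g h n) - 1), norm_nonneg (ρ.trans (iterComm g h n))]
  exact ⟨sub_eq_zero.1 (norm_eq_zero.1 h2), norm_eq_zero.1 h3⟩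

/-- Elements with small rotations commute up to a translation along the axes. -/
theorem commutator_of_small (hfin : ∀ R : ℝ, {g | ‖ρ.trans g‖ ≤ R}.Finite) {g h : Γ}
    (hg : ‖ρ.rot g - 1‖ ≤ 1 / 8) (hh : ‖ρ.rot h - 1‖ ≤ 1 / 8) :
    ρ.rot ⁅g, h⁆ = 1 ∧ ρ.rot h (ρ.trans ⁅g, h⁆) = ρ.trans ⁅g, h⁆ := by
  obtain ⟨N, hN⟩ := ρ.eventually_iterComm hfin hg hh
  have hsmall (n : ℕ) : ‖ρ.rot (iterComm g h n) - 1‖ ≤ 1 / 8 :=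
    (ρ.norm_rot_iterComm_le hg hh n).trans
      (mul_le_of_le_one_right (by norm_num) (pow_le_one₀ (by norm_num) (by norm_num)))
  -- Descent from the index where the commutators become trivial; it stops at `⁅g, h⁆`.
  have hrot (n : ℕ) : ρ.rot (iterComm g h (n + 1)) = 1 := by
    by_cases hn : N ≤ n
    · exact (hN _ (by omega)).1
    · have step (k : ℕ) (hk : ρ.rot (iterComm g h (k + 2)) = 1) :
          ρ.rot (iterComm g h (k + 1)) = 1 := by
        refine ρ.rot_commutator_eq_one (hsmall k) ?_
        change ρ.rot ⁅iterComm g h (k + 1), h⁆ = 1 at hk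
        have e : ⁅iterComm g h (k + 1), h⁆ * (h * iterComm g h (k + 1)) =
            iterComm g h (k + 1) * h := by rw [commutatorElement_def]; group
        have e2 := congrArg ρ.rot e
        rw [map_mul, hk, one_mul, map_mul, map_mul] at e2
        exact e2.symm
      refine Nat.decreasingInduction' (P := fun k => ρ.rot (iterComm g h (k + 1)) = 1)
        (fun k _ _ hk => step k hk) (show n ≤ N by omega) (hN _ (by omega)).1
  have htr (n : ℕ) : ρ.trans (iterComm g h (n + 2)) =
      ρ.trans (iterComm g h (n + 1)) - ρ.rot h (ρ.trans (iterComm g h (n + 1))) := by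
    set β := iterComm g h (n + 1) with hβ
    have hβ1 : ρ.rot β = 1 := hrot n
    have e : ρ.trans (⁅β, h⁆ * (h * β)) = ρ.trans (β * h) := by
      congr 1; rw [commutatorElement_def]; group
    have h1 : ρ.rot ⁅β, h⁆ = 1 := hrot (n + 1)
    rw [trans_mul, trans_mul, trans_mul, h1, hβ1, one_apply_eq_self, one_apply_eq_self] at e
    change ρ.trans ⁅β, h⁆ = _
    rw [eq_sub_iff_add_eq]
    have e3 : ρ.trans ⁅β, h⁆ + (ρ.trans h + ρ.rot h (ρ.trans β)) - ρ.trans h =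
      ρ.trans β + ρ.trans h - ρ.trans h := by rw [e]
    rw [add_sub_cancel_right] at e3
    conv_rhs => rw [← e3]
    abel
  -- By `htr` each step applies `1 - rot h`, whose square has the same kernel because `rot h` is an
  -- isometry; hence a second descent.
  have hzero (n : ℕ) : ρ.trans (iterComm g h (n + 2)) = 0 := by
    by_cases hn : N ≤ n
    · exact (hN _ (by omega)).2
    · have step (k : ℕ) (hk : ρ.trans (iterComm g h (k + 3)) = 0) :
          ρ.trans (iterComm g h (k + 2)) = 0 := by
        set w := ρ.trans (iterComm g h (k + 1)) with hw
        have h2 := htr k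
        have h3 := htr (k + 1)
        rw [hk, show k + 1 + 1 = k + 2 from rfl] at h3
        have h4 : ρ.rot h (ρ.trans (iterComm g h (k + 2))) = ρ.trans (iterComm g h (k + 2)) :=
          (sub_eq_zero.1 h3.symm).symm
        have h5 : ρ.rot h w = w := by
          refine ContinuousLinearMap.apply_eq_of_apply_sub_eq (ρ.norm_rot h) ?_
          rw [← neg_sub w, ← h2, map_neg, h4]
        rw [h2, h5, sub_self]
      refine Nat.decreasingInduction' (P := fun k => ρ.trans (iterComm g h (k + 2)) = 0)
        (fun k _ _ hk => step k hk) (show n ≤ N by omega) (hN _ (by omega)).2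
  refine ⟨hrot 0, ?_⟩
  have := htr 0
  rw [hzero 0] at this
  exact (sub_eq_zero.1 this.symm).symm

theorem norm_trans_pow_le (g : Γ) (n : ℕ) : ‖ρ.trans (g ^ n)‖ ≤ n * ‖ρ.trans g‖ := by
  induction n with
  | zero => simp [trans_one]
  | succ n ih =>
    rw [pow_succ, trans_mul]
    refine (norm_add_le _ _).trans ?_
    rw [norm_rot]; push_cast; linarith

/-- The displacement of an element with small rotation is bounded on the orbit of `0` under the
elements with small rotation. -/
theorem norm_rot_trans_sub_le (hfin : ∀ R : ℝ, {g | ‖ρ.trans g‖ ≤ R}.Finite) {g h : Γ}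
    (hg : ‖ρ.rot g - 1‖ ≤ 1 / 8) (hh : ‖ρ.rot h - 1‖ ≤ 1 / 8) :
    ‖(ρ.rot h - 1) (ρ.trans g)‖ ≤ 4 * ‖ρ.trans h‖ := by
  obtain ⟨h1, h2⟩ := ρ.commutator_of_small hfin ((ρ.norm_rot_inv_sub_one_le g).trans hg) hh
  set τ := ⁅g⁻¹, h⁆ with hτ
  have hτh : τ * h = g⁻¹ * h * g := by rw [hτ, commutatorElement_def]; group
  have hpow (n : ℕ) : ρ.trans ((τ * h) ^ n) = (n : ℝ) • ρ.trans τ + ρ.trans (h ^ n) := by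
    induction n with
    | zero => simp [trans_one]
    | succ n ih =>
      rw [pow_succ', trans_mul, ih, trans_mul, map_mul, h1, one_mul, map_add, map_smul, h2,
        pow_succ', trans_mul, one_apply_eq_self]
      push_cast; rw [add_smul, one_smul]; abel
  -- Powers of `τ * h` drift by `n • trans τ` relative to those of `h`, but they are conjugates by
  -- `g`, which costs only `2 * ‖trans g‖`. Dividing by `n` removes the dependence on `g`.
  have hτn : ‖ρ.trans τ‖ ≤ 2 * ‖ρ.trans h‖ := by
    have hb (n : ℕ) : n * (‖ρ.trans τ‖ - 2 * ‖ρ.trans h‖) ≤ 2 * ‖ρ.trans g‖ := by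
      have e1 : (τ * h) ^ n = g⁻¹ * h ^ n * g := by
        have := conj_pow (i := n) (a := g⁻¹) (b := h)
        rwa [inv_inv, ← hτh] at this
      have e2 : ‖ρ.trans ((τ * h) ^ n)‖ ≤ 2 * ‖ρ.trans g‖ + ‖ρ.trans (h ^ n)‖ := by
        rw [e1, trans_mul, trans_mul]
        refine (norm_add_le _ _).trans ?_
        have := norm_add_le (ρ.trans g⁻¹) (ρ.rot g⁻¹ (ρ.trans (h ^ n)))
        rw [norm_rot, norm_trans_inv] at this
        rw [norm_rot]; linarith
      have e3 : ‖(n : ℝ) • ρ.trans τ‖ ≤ ‖ρ.trans ((τ * h) ^ n)‖ + ‖ρ.trans (h ^ n)‖ := by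
        have := norm_sub_le (ρ.trans ((τ * h) ^ n)) (ρ.trans (h ^ n))
        rwa [hpow, add_sub_cancel_right, ← hpow] at this
      rw [norm_smul, Real.norm_natCast] at e3
      have e4 := ρ.norm_trans_pow_le h n
      linarith
    by_contra! hlt
    obtain ⟨n, hn⟩ := exists_nat_gt (2 * ‖ρ.trans g‖ / (‖ρ.trans τ‖ - 2 * ‖ρ.trans h‖))
    rw [div_lt_iff₀ (by linarith)] at hn
    linarith [hb n]
  have e : h * g = g * (τ * h) := by rw [hτh]; group
  have e2 := congrArg ρ.trans e
  rw [trans_mul, trans_mul, trans_mul, h1, one_apply_eq_self] at e2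
  have e3 : (ρ.rot h - 1) (ρ.trans g) = ρ.rot g (ρ.trans τ + ρ.trans h) - ρ.trans h := by
    rw [sub_apply, one_apply_eq_self, sub_eq_sub_iff_add_eq_add, add_comm _ (ρ.trans h), e2,
      add_comm]
  rw [e3]
  refine (norm_sub_le _ _).trans ?_
  rw [norm_rot]
  linarith [norm_add_le (ρ.trans τ) (ρ.trans h)]

/-- Rotations form a totally bounded set. Dividing `g` by a representative from a finite net makes
its rotation small and moves the orbit point boundedly. -/
theorem exists_small_near [FiniteDimensional ℝ V] {C : ℝ} (hC : ∀ v, ∃ g, ‖v - ρ.trans g‖ ≤ C)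
    {ε : ℝ} (hε : 0 < ε) :
    ∃ C' : ℝ, ∀ v, ∃ g, ‖ρ.rot g - 1‖ ≤ ε ∧ ‖v - ρ.trans g‖ ≤ C' := by
  have htb : TotallyBounded (Set.range ρ.rot) := by
    have : ProperSpace (V →L[ℝ] V) := FiniteDimensional.proper ℝ _
    refine (isCompact_closedBall (0 : V →L[ℝ] V) 1).totallyBounded.subset ?_
    rintro _ ⟨g, rfl⟩
    simpa using ρ.norm_rot_le g
  obtain ⟨t, ht, htf, hcov⟩ := Metric.finite_approx_of_totallyBounded htb ε hε
  have ht' : ∀ A ∈ t, ∃ g, ρ.rot g = A := fun A hA => ht hA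
  choose! γ hγ using ht'
  obtain ⟨M, hM⟩ := (htf.image fun A => ‖ρ.trans (γ A)‖).bddAbove
  refine ⟨C + M, fun v => ?_⟩
  obtain ⟨g, hg⟩ := hC v
  obtain ⟨A, hA, hgA⟩ := Set.mem_iUnion₂.1 (hcov ⟨g, rfl⟩)
  refine ⟨g * (γ A)⁻¹, ?_, ?_⟩
  · refine (ρ.norm_rot_mul_inv_sub_one_le _ _).trans ?_
    rw [hγ A hA, ← dist_eq_norm]
    exact (Metric.mem_ball.1 hgA).le
  · have h1 : ‖ρ.trans (γ A)‖ ≤ M := hM ⟨A, hA, rfl⟩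
    rw [trans_mul, ← sub_sub]
    refine (norm_sub_le _ _).trans ?_
    rw [norm_rot, norm_trans_inv]
    linarith

/-- Elements with small rotation are translations. -/
theorem rot_eq_one_of_small [FiniteDimensional ℝ V]
    (hfin : ∀ R : ℝ, {g | ‖ρ.trans g‖ ≤ R}.Finite) {C : ℝ} (hC : ∀ v, ∃ g, ‖v - ρ.trans g‖ ≤ C)
    {h : Γ} (hh : ‖ρ.rot h - 1‖ ≤ 1 / 8) : ρ.rot h = 1 := by
  obtain ⟨C', hC'⟩ := ρ.exists_small_near hC (show (0 : ℝ) < 1 / 8 by norm_num)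
  refine sub_eq_zero.1 (ContinuousLinearMap.ext fun v => ?_)
  -- The map `rot h - 1` is bounded on orbit points of small rotation, which are cobounded; so it is
  -- bounded on the whole line through `v`.
  refine eq_zero_of_nat_mul_norm_le (C := 4 * ‖ρ.trans h‖ + 2 * C') fun n => ?_
  obtain ⟨g, hg, hgC⟩ := hC' ((n : ℝ) • v)
  have h1 := ρ.norm_rot_trans_sub_le hfin hg hh
  have h2 : ‖(ρ.rot h - 1) ((n : ℝ) • v - ρ.trans g)‖ ≤ 2 * C' :=
    ((ρ.rot h - 1).le_of_opNorm_le (ρ.norm_rot_sub_one_le h) _).trans (by gcongr)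
  have h3 : (n : ℝ) • (ρ.rot h - 1) v =
      (ρ.rot h - 1) (ρ.trans g) + (ρ.rot h - 1) ((n : ℝ) • v - ρ.trans g) := by
    rw [← map_add, add_sub_cancel, map_smul]
  calc n * ‖(ρ.rot h - 1) v‖ = ‖(n : ℝ) • (ρ.rot h - 1) v‖ := by rw [norm_smul]; simp
    _ ≤ _ := by rw [h3]; exact (norm_add_le _ _).trans (add_le_add h1 h2)

theorem trans_pow_of_rot_eq_one {g : Γ} (hg : ρ.rot g = 1) (n : ℕ) :
    ρ.trans (g ^ n) = n • ρ.trans g := by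
  induction n with
  | zero => simp [trans_one]
  | succ n ih =>
    rw [pow_succ, trans_mul, ih, map_pow, hg, one_pow, one_apply_eq_self, add_smul, one_smul]

/-- The conjugates of `h` by powers of `g` all have translation part `trans h`, so two of them
coincide. A power is needed because the action need not be faithful. -/
theorem exists_pow_commute (hfin : ∀ R : ℝ, {g | ‖ρ.trans g‖ ≤ R}.Finite) {g h : Γ}
    (hg : ρ.rot g = 1) (hh : ρ.rot h = 1) : ∃ n : ℕ, 0 < n ∧ Commute (g ^ n) h := by
  have hmem (n : ℕ) : g ^ n * h * (g ^ n)⁻¹ ∈ {x | ‖ρ.trans x‖ ≤ ‖ρ.trans h‖} := by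
    have e : ρ.trans (g ^ n * h * (g ^ n)⁻¹ * g ^ n) = ρ.trans (g ^ n * h) := by
      rw [inv_mul_cancel_right]
    have hr : ρ.rot (g ^ n) = 1 := by rw [map_pow, hg, one_pow]
    have hr' : ρ.rot (g ^ n * h * (g ^ n)⁻¹) = 1 := by
      have : ρ.rot (g ^ n)⁻¹ = 1 := by
        have := map_mul ρ.rot (g ^ n) (g ^ n)⁻¹
        rwa [mul_inv_cancel, map_one, hr, one_mul, eq_comm] at this
      rw [map_mul, map_mul, hr, hh, this, one_mul, one_mul]
    rw [ρ.trans_mul _ (g ^ n), hr', ρ.trans_mul _ h, hr, one_apply_eq_self, one_apply_eq_self, add_comm,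
      add_left_cancel_iff] at e
    exact (congrArg norm e).le
  obtain ⟨m, n, hmn, heq⟩ := Set.Finite.exists_lt_map_eq_of_forall_mem hmem (hfin _)
  refine ⟨n - m, by omega, ?_⟩
  have hn : g ^ n = g ^ m * g ^ (n - m) := by rw [← pow_add]; congr 1; omega
  rw [hn, mul_inv_rev] at heq
  have h2 : h = g ^ (n - m) * h * (g ^ (n - m))⁻¹ := by
    have := congrArg (fun x => (g ^ m)⁻¹ * x * g ^ m) heq
    simpa [mul_assoc] using this
  exact (eq_mul_inv_iff_mul_eq.1 h2).symm

theorem exists_pow_commute_all {ι : Type*} [Fintype ι]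
    (hfin : ∀ R : ℝ, {g | ‖ρ.trans g‖ ≤ R}.Finite) {τ : ι → Γ}
    (hτ : ∀ i, ρ.rot (τ i) = 1) :
    ∃ n : ℕ, 0 < n ∧ ∀ i j, Commute (τ i ^ n) (τ j ^ n) := by
  choose n hn hc using fun p : ι × ι => ρ.exists_pow_commute hfin (hτ p.1) (hτ p.2)
  refine ⟨∏ p, n p, Finset.prod_pos fun p _ => hn p, fun i j => Commute.pow_right ?_ _⟩
  obtain ⟨m, hm⟩ := Finset.dvd_prod_of_mem n (Finset.mem_univ (i, j))
  rw [hm, pow_mul]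
  exact (hc (i, j)).pow_left m

end

end EuclideanAction

/-! ### Bieberbach's theorem: a translation lattice of finite index. -/

namespace EuclideanAction

variable {Γ V : Type*} [Group Γ] [NormedAddCommGroup V] [InnerProductSpace ℝ V]
  [FiniteDimensional ℝ V] (ρ : EuclideanAction Γ V)

/-- The translations in a crystallographic group span the space. -/
theorem span_translations (hfin : ∀ R : ℝ, {g | ‖ρ.trans g‖ ≤ R}.Finite)
    {C : ℝ} (hC : ∀ v, ∃ g, ‖v - ρ.trans g‖ ≤ C) :
    Submodule.span ℝ (ρ.trans '' {g | ρ.rot g = 1}) = ⊤ := by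
  obtain ⟨C', hC'⟩ := ρ.exists_small_near hC (show (0 : ℝ) < 1 / 8 by norm_num)
  set S := Submodule.span ℝ (ρ.trans '' {g | ρ.rot g = 1}) with hS
  rw [← Submodule.orthogonal_eq_bot_iff, Submodule.eq_bot_iff]
  intro v hv
  refine eq_zero_of_nat_mul_norm_le (C := C') fun n => ?_
  obtain ⟨g, hg, hgC⟩ := hC' ((n : ℝ) • v)
  have hgS : ρ.trans g ∈ S :=
    Submodule.subset_span ⟨g, ρ.rot_eq_one_of_small hfin hC hg, rfl⟩
  have h1 : inner ℝ ((n : ℝ) • v) (ρ.trans g) = 0 :=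
    Submodule.inner_left_of_mem_orthogonal hgS (Submodule.smul_mem _ _ hv)
  have h2 := norm_sub_sq_eq_norm_sq_add_norm_sq_real h1
  refine le_trans ?_ hgC
  have h3 : ‖(n : ℝ) • v‖ ≤ ‖(n : ℝ) • v - ρ.trans g‖ := by
    refine abs_le_of_sq_le_sq' ?_ (norm_nonneg _) |>.2
    nlinarith [mul_self_nonneg ‖ρ.trans g‖]
  rwa [norm_smul, Real.norm_natCast] at h3

theorem exists_basis_translations (hfin : ∀ R : ℝ, {g | ‖ρ.trans g‖ ≤ R}.Finite)
    {C : ℝ} (hC : ∀ v, ∃ g, ‖v - ρ.trans g‖ ≤ C) :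
    ∃ (τ : Fin (Module.finrank ℝ V) → Γ) (b : Module.Basis (Fin (Module.finrank ℝ V)) ℝ V),
      ∀ i, ρ.rot (τ i) = 1 ∧ ρ.trans (τ i) = b i := by
  have hs := (ρ.span_translations hfin hC).ge
  have := Module.Finite.finite_basis (Module.Basis.ofSpan hs)
  have := Fintype.ofFinite ((linearIndepOn_empty ℝ id).extend
    (Set.empty_subset (ρ.trans '' {g | ρ.rot g = 1})))
  set b := (Module.Basis.ofSpan hs).reindex (Fintype.equivFinOfCardEq
    (Module.finrank_eq_card_basis (Module.Basis.ofSpan hs)).symm) with hb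
  have hmem (i) : b i ∈ ρ.trans '' {g | ρ.rot g = 1} := by
    rw [hb, Module.Basis.reindex_apply]
    exact Module.Basis.ofSpan_subset hs ⟨_, rfl⟩
  choose τ h1 h2 using hmem
  exact ⟨τ, b, fun i => ⟨h1 i, h2 i⟩⟩

open scoped IsMulCommutative in
/-- Bieberbach's theorem: a group that acts properly discontinuously and cocompactly on a Euclidean
space is virtually abelian of rank at least the dimension of the space. -/
theorem exists_abelian_finiteIndex (hfin : ∀ R : ℝ, {g | ‖ρ.trans g‖ ≤ R}.Finite)
    {C : ℝ} (hC : ∀ v, ∃ g, ‖v - ρ.trans g‖ ≤ C) :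
    ∃ (A : Subgroup Γ) (_ : IsMulCommutative A), A.FiniteIndex ∧
      (Module.finrank ℝ V : Cardinal) ≤ Module.rank ℤ (Additive A) := by
  obtain ⟨τ, b, hτ⟩ := ρ.exists_basis_translations hfin hC
  obtain ⟨n, hn, hcomm⟩ := ρ.exists_pow_commute_all hfin (fun i => (hτ i).1)
  set σ : Fin (Module.finrank ℝ V) → Γ := fun i => τ i ^ n with hσ
  have hσ1 (i) : ρ.rot (σ i) = 1 := by rw [hσ, map_pow, (hτ i).1, one_pow]
  have hσ2 (i) : ρ.trans (σ i) = n • b i := by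
    rw [hσ, ρ.trans_pow_of_rot_eq_one (hτ i).1, (hτ i).2]
  set A := Subgroup.closure (Set.range σ) with hA
  have hAc : IsMulCommutative A := Subgroup.isMulCommutative_closure (by
    rintro _ ⟨i, rfl⟩ _ ⟨j, rfl⟩
    exact hcomm i j)
  have hAr (s : Γ) (hs : s ∈ A) : ρ.rot s = 1 := by
    have : A ≤ ρ.rot.ker := by
      rw [hA, Subgroup.closure_le]
      rintro _ ⟨i, rfl⟩
      exact hσ1 i
    exact this hs
  let t : Additive A →+ V :=
    { toFun := fun s => ρ.trans (s.toMul : A)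
      map_zero' := ρ.trans_one
      map_add' := fun s s' => by
        change ρ.trans ((s.toMul : A) * (s'.toMul : A) : Γ) = _
        rw [trans_mul, hAr _ s.toMul.2]; rfl }
  let v : Fin (Module.finrank ℝ V) → Additive A :=
    fun i => Additive.ofMul ⟨σ i, Subgroup.subset_closure ⟨i, rfl⟩⟩
  have htv (i) : t (v i) = n • b i := hσ2 i
  refine ⟨A, hAc, ?_, ?_⟩
  · -- every element lies in the product of `A` and a finite set
    have hn' : (n : ℝ) ≠ 0 := by exact_mod_cast hn.ne'
    set M := ∑ i, n * ‖b i‖ with hM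
    -- Rounding down the coordinates in the lattice basis `n • b i` leaves a remainder in the
    -- fundamental box, hence in a finite set of group elements.
    have hfac (g : Γ) : ∃ s ∈ A, ∃ x ∈ {x | ‖ρ.trans x‖ ≤ M}, g = s * x := by
      set c : Fin (Module.finrank ℝ V) → ℤ := fun i => ⌊b.repr (ρ.trans g) i / n⌋ with hc
      set s : Additive A := ∑ i, c i • v i with hs
      refine ⟨(s.toMul : A), s.toMul.2, ((s.toMul : A) : Γ)⁻¹ * g, ?_, by group⟩
      have hts : ρ.trans (s.toMul : A) = ∑ i, (c i * n : ℝ) • b i := by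
        change t s = _
        rw [hs, map_sum]
        refine Finset.sum_congr rfl fun i _ => ?_
        rw [map_zsmul, htv, mul_smul, Int.cast_smul_eq_zsmul, Nat.cast_smul_eq_nsmul]
      have h1 : ρ.trans (((s.toMul : A) : Γ)⁻¹ * g) =
          ∑ i, (b.repr (ρ.trans g) i - c i * n) • b i := by
        rw [trans_mul, trans_inv, hAr _ (A.inv_mem s.toMul.2), one_apply_eq_self, one_apply_eq_self,
          hts]
        conv_lhs => rw [← b.sum_repr (ρ.trans g)]
        rw [neg_add_eq_sub, ← Finset.sum_sub_distrib]
        simp only [sub_smul]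
      rw [Set.mem_ofPred_eq, h1]
      refine (norm_sum_le _ _).trans (Finset.sum_le_sum fun i _ => ?_)
      rw [norm_smul]
      gcongr
      have h2 := Int.floor_le (b.repr (ρ.trans g) i / n)
      have h3 := Int.lt_floor_add_one (b.repr (ρ.trans g) i / n)
      have hn0 : (0 : ℝ) < n := by exact_mod_cast hn
      rw [le_div_iff₀ hn0] at h2
      rw [div_lt_iff₀ hn0] at h3
      rw [Real.norm_eq_abs, abs_le]
      constructor <;> simp only [hc] <;> linarith
    have : Finite {x | ‖ρ.trans x‖ ≤ M} := hfin M
    have : Finite (Γ ⧸ A) := by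
      refine Finite.of_surjective
        (fun x : {x | ‖ρ.trans x‖ ≤ M} => (QuotientGroup.mk (x : Γ)⁻¹ : Γ ⧸ A)) fun q => ?_
      obtain ⟨g, rfl⟩ := QuotientGroup.mk_surjective q
      obtain ⟨s, hs, x, hx, hgx⟩ := hfac g⁻¹
      refine ⟨⟨x, hx⟩, QuotientGroup.eq.2 ?_⟩
      have : g = x⁻¹ * s⁻¹ := by rw [← inv_inv g, hgx, mul_inv_rev]
      simpa [this] using hs
    exact Subgroup.finiteIndex_of_finite_quotient
  · rw [Module.le_rank_iff]
    refine ⟨v, LinearIndependent.of_comp t.toIntLinearMap ?_⟩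
    have h1 : LinearIndependent ℝ fun i => (n : ℝ) • b i :=
      b.linearIndependent.units_smul fun _ => Units.mk0 (n : ℝ) (by exact_mod_cast hn.ne')
    have h2 : (t.toIntLinearMap ∘ v) = fun i => (n : ℝ) • b i := by
      funext i
      rw [Nat.cast_smul_eq_nsmul]; exact htv i
    rw [h2]
    refine h1.restrict_scalars fun x y hxy => ?_
    simpa using hxy

end EuclideanAction

/-! ### Isolated flats and their stabilizers. -/

theorem IsFlat.nonempty {X : Type*} [MetricSpace X] {F : Set X} (hF : IsFlat F) : F.Nonempty := by
  obtain ⟨k, -, f, -, rfl⟩ := hF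
  exact Set.range_nonempty f

theorem IsFlat.exists_dist_eq {X : Type*} [MetricSpace X] {F : Set X} (hF : IsFlat F) {p : X}
    (hp : p ∈ F) {r : ℝ} (hr : 0 ≤ r) : ∃ q ∈ F, dist p q = r := by
  obtain ⟨k, hk, f, hf, rfl⟩ := hF
  obtain ⟨v, rfl⟩ := hp
  refine ⟨_, ⟨v + r • EuclideanSpace.single ⟨0, by omega⟩ 1, rfl⟩, ?_⟩
  rw [hf.dist_eq, dist_self_add_right, norm_smul, PiLp.norm_single]
  simp [abs_of_nonneg hr]

namespace IsIsolatedFlatsFamily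

variable {G X : Type*} [Group G] [MetricSpace X] [MulAction G X] {𝓕 : Set (Set X)}

theorem eq_of_near (h𝓕 : IsIsolatedFlatsFamily 𝓕) {F₁ F₂ : Set X} (h₁ : F₁ ∈ 𝓕) (h₂ : F₂ ∈ 𝓕)
    {S : Set X} (hS : ¬ Bornology.IsBounded S) {r₁ r₂ : ℝ}
    (hr₁ : ∀ y ∈ S, ∃ z ∈ F₁, dist y z ≤ r₁) (hr₂ : ∀ y ∈ S, ∃ z ∈ F₂, dist y z ≤ r₂) :
    F₁ = F₂ := by
  by_contra hne
  obtain ⟨ψ, hψ⟩ := h𝓕.isolated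
  set k : ℝ≥0 := (max r₁ r₂).toNNReal with hk
  have hk' : max r₁ r₂ ≤ k := Real.le_coe_toNNReal _
  refine hS (Metric.isBounded_iff_ediam_ne_top.2 (ne_top_of_le_ne_top (ENNReal.coe_ne_top (r := ψ k))
    (le_trans (Metric.ediam_mono ?_) (hψ F₁ h₁ F₂ h₂ hne k))))
  refine fun y hy => ⟨?_, ?_⟩
  · obtain ⟨z, hz, hyz⟩ := hr₁ y hy
    exact Metric.mem_cthickening_of_dist_le y z _ _ hz (hyz.trans ((le_max_left _ _).trans hk'))
  · obtain ⟨z, hz, hyz⟩ := hr₂ y hy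
    exact Metric.mem_cthickening_of_dist_le y z _ _ hz (hyz.trans ((le_max_right _ _).trans hk'))

theorem smul_mem [IsIsometricSMul G X] (h𝓕 : IsIsolatedFlatsFamily 𝓕) (g : G) {F : Set X}
    (hF : F ∈ 𝓕) : g • F ∈ 𝓕 :=
  h𝓕.equivariant (IsometryEquiv.constSMul g) F hF

end IsIsolatedFlatsFamily

theorem smul_mem_of_mem_stabilizer {G X : Type*} [Group G] [MulAction G X] {g : G} {F : Set X} (hg : g ∈ MulAction.stabilizer G F) {x : X}
    (hx : x ∈ F) : g • x ∈ F := by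
  rw [← MulAction.mem_stabilizer_iff.1 hg]
  exact Set.smul_mem_smul_set hx

theorem IsGeometricAction.not_isBounded_orbit {G X : Type*} [Group G] [MetricSpace X]
    [MulAction G X] [ProperSpace X] (hG : IsGeometricAction G X) {B : Set G} (hB : B.Infinite)
    (x : X) : ¬ Bornology.IsBounded ((fun g : G => g • x) '' B) := fun h => by
  refine hB ((hG.finite_smul_inter (isCompact_singleton (x := x)) h.isCompact_closure).subset ?_)
  exact fun g hg => ⟨x, rfl, subset_closure ⟨g, hg, rfl⟩⟩

section

variable {G X : Type*} [Group G] [MetricSpace X] [MulAction G X] {𝓕 : Set (Set X)}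

/-- The orbit of `x ∈ F₁` under `B` is unbounded, lies in `F₁`, and stays within `dist x y` of `F₂`
for `y ∈ F₂`. -/
theorem IsIsolatedFlatsFamily.eq_of_infinite_stabilizer [ProperSpace X]
    (h𝓕 : IsIsolatedFlatsFamily 𝓕) (hG : IsGeometricAction G X) {F₁ F₂ : Set X} (h₁ : F₁ ∈ 𝓕)
    (h₂ : F₂ ∈ 𝓕) {B : Set G} (hB : B.Infinite) (hB₁ : ∀ g ∈ B, g ∈ MulAction.stabilizer G F₁)
    (hB₂ : ∀ g ∈ B, g ∈ MulAction.stabilizer G F₂) : F₁ = F₂ := by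
  have := hG.isometric
  obtain ⟨x, hx⟩ := (h𝓕.isFlat F₁ h₁).nonempty
  obtain ⟨y, hy⟩ := (h𝓕.isFlat F₂ h₂).nonempty
  refine h𝓕.eq_of_near h₁ h₂ (hG.not_isBounded_orbit hB x) (r₁ := 0) (r₂ := dist x y) ?_ ?_
  · rintro _ ⟨g, hg, rfl⟩
    exact ⟨g • x, smul_mem_of_mem_stabilizer (hB₁ g hg) hx, by simp⟩
  · rintro _ ⟨g, hg, rfl⟩
    exact ⟨g • y, smul_mem_of_mem_stabilizer (hB₂ g hg) hy, by simp [dist_smul]⟩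

open scoped IsMulCommutative in
theorem IsVirtuallyAbelianOfRankGE.exists_abelian {H : Subgroup G}
    (hH : IsVirtuallyAbelianOfRankGE 2 H) : ∃ A : Subgroup G, A ≤ H ∧
      (∀ x ∈ A, ∀ y ∈ A, Commute x y) ∧ (∀ h ∈ H, ∃ n : ℕ, 0 < n ∧ h ^ n ∈ A) ∧
      ∃ a ∈ A, ∃ b ∈ A, Function.Injective fun g : ℤ × ℤ => a ^ g.1 * b ^ g.2 := by
  obtain ⟨A, hA, hfin, hrank⟩ := hH
  obtain ⟨v, hv⟩ := Module.le_rank_iff.1 (by exact_mod_cast hrank)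
  refine ⟨A.map H.subtype, Subgroup.map_subtype_le A, ?_, fun h hh => ?_,
    _, ⟨_, (v 0).toMul.2, rfl⟩, _, ⟨_, (v 1).toMul.2, rfl⟩, ?_⟩
  · rintro _ ⟨x, hx, rfl⟩ _ ⟨y, hy, rfl⟩
    have : (⟨x, hx⟩ : A) * ⟨y, hy⟩ = ⟨y, hy⟩ * ⟨x, hx⟩ := mul_comm _ _
    exact congrArg (fun z : A => ((z : H) : G)) this
  · obtain ⟨n, hn, -, hmem⟩ := Subgroup.exists_pow_mem_of_index_ne_zero hfin.index_ne_zero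
      (⟨h, hh⟩ : H)
    exact ⟨n, hn, ⟨_, hmem, rfl⟩⟩
  · have h1 : Function.Injective fun g : ℤ × ℤ => g.1 • v 0 + g.2 • v 1 := fun g h hgh => by
      have h2 := Fintype.linearIndependent_iff.1 hv ![g.1 - h.1, g.2 - h.2] (by
        simp only [Fin.sum_univ_two, Matrix.cons_val_zero, Matrix.cons_val_one, sub_smul]
        simp only at hgh
        rw [sub_add_sub_comm, hgh, sub_self])
      have e0 := h2 0
      have e1 := h2 1
      simp only [Matrix.cons_val_zero, Matrix.cons_val_one] at e0 e1
      exact Prod.ext (sub_eq_zero.1 e0) (sub_eq_zero.1 e1)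
    exact (Subtype.val_injective.comp (Subtype.val_injective.comp
      (Additive.toMul.injective.comp h1)) :)

theorem injective_zpow_of_injective {a b : G}
    (h : Function.Injective fun g : ℤ × ℤ => a ^ g.1 * b ^ g.2) {n : ℕ} (hn : 0 < n) :
    (Set.range fun i : ℤ => (a ^ n) ^ i).Infinite := by
  refine Set.infinite_range_of_injective fun i j hij => ?_
  have h1 : ((n : ℤ) * i, (0 : ℤ)) = (n * j, 0) := h (by
    simpa only [zpow_mul, zpow_natCast, zpow_zero, mul_one] using hij)
  have h2 := (Prod.mk.inj h1).1
  exact mul_left_cancel₀ (by exact_mod_cast hn.ne') h2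

theorem IsVirtuallyAbelianOfRankGE.infinite {H : Subgroup G}
    (hH : IsVirtuallyAbelianOfRankGE 2 H) : (H : Set G).Infinite := by
  obtain ⟨A, hAH, -, -, a, ha, b, hb, hinj⟩ := hH.exists_abelian
  refine (injective_zpow_of_injective hinj zero_lt_one).mono ?_
  rintro _ ⟨i, rfl⟩
  exact H.zpow_mem (H.pow_mem (hAH ha) 1) i

/-- Every virtually abelian subgroup of rank at least two stabilizes a distinguished flat. -/
theorem IsIsolatedFlatsFamily.exists_le_stabilizer [Nonempty X] [ProperSpace X]
    (h𝓕 : IsIsolatedFlatsFamily 𝓕) (hX : ∀ y z : X, ∃ m, IsCNMidpoint m y z)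
    (hG : IsGeometricAction G X) {H : Subgroup G}
    (hH : IsVirtuallyAbelianOfRankGE 2 H) : ∃ F ∈ 𝓕, H ≤ MulAction.stabilizer G F := by
  have := hG.isometric
  obtain ⟨A, hAH, hAc, hpow, a, ha, b, hb, hinj⟩ := hH.exists_abelian
  obtain ⟨x, f, hf, hxf⟩ := exists_isometry_plane_of_commute hX hG (hAc a ha b hb) hinj
  obtain ⟨B, hB⟩ := h𝓕.maximal
  obtain ⟨F, hF, hfF⟩ := hB (Set.range f) ⟨2, le_rfl, f, hf, rfl⟩
  set L : Set G := Set.range fun g : ℤ × ℤ => a ^ g.1 * b ^ g.2 with hL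
  have hLinf : L.Infinite := Set.infinite_range_of_injective hinj
  have hLA (g : G) (hg : g ∈ L) : g ∈ A := by
    obtain ⟨g, rfl⟩ := hg
    exact A.mul_mem (A.zpow_mem ha _) (A.zpow_mem hb _)
  have hnear (g : G) (hg : g ∈ L) : ∃ z ∈ F, dist (g • x) z ≤ B + 1 := by
    obtain ⟨g, rfl⟩ := hg
    have h1 := Metric.cthickening_subset_thickening' (by positivity)
      (show (B : ℝ) < B + 1 by linarith) F (hfF (hxf g.1 g.2))
    obtain ⟨z, hz, hd⟩ := Metric.mem_thickening_iff.1 h1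
    exact ⟨z, hz, hd.le⟩
  -- As `c` commutes with `L`, it moves every point of the orbit `L • x` by the same distance, so
  -- this orbit is near both `c • F` and `F`.
  have hAF : A ≤ MulAction.stabilizer G F := fun c hc => by
    rw [MulAction.mem_stabilizer_iff]
    refine h𝓕.eq_of_near (h𝓕.smul_mem c hF) hF (hG.not_isBounded_orbit hLinf x)
      (r₁ := dist x (c • x) + (B + 1)) (r₂ := B + 1) ?_ ?_
    · rintro _ ⟨g, hg, rfl⟩
      obtain ⟨z, hz, hd⟩ := hnear g hg
      refine ⟨c • z, Set.smul_mem_smul_set hz, ?_⟩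
      refine (dist_triangle (g • x) (c • g • x) (c • z)).trans ?_
      have hcg : c • g • x = g • c • x := by
        rw [smul_smul, smul_smul, (hAc c hc g (hLA g hg)).eq]
      rw [dist_smul, hcg, dist_smul]
      linarith
    · rintro _ ⟨g, hg, rfl⟩
      exact hnear g hg
  refine ⟨F, hF, fun h hh => ?_⟩
  -- Some power of `h⁻¹ * a * h` lies in `A` and preserves `F`; so `a ^ n` preserves both `h • F`
  -- and `F`.
  obtain ⟨n, hn, hmem⟩ := hpow (h⁻¹ * a * h) (H.mul_mem (H.mul_mem (H.inv_mem hh) (hAH ha)) hh)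
  have e1 : (h⁻¹ * a * h) ^ n = h⁻¹ * a ^ n * h := by
    simpa using conj_pow (i := n) (a := h⁻¹) (b := a)
  rw [e1] at hmem
  have h1 : a ^ n ∈ MulAction.stabilizer G (h • F) := by
    have h2 := MulAction.mem_stabilizer_iff.1 (hAF hmem)
    rw [MulAction.mem_stabilizer_iff]
    rw [mul_assoc, mul_smul, inv_smul_eq_iff, mul_smul] at h2
    exact h2
  rw [MulAction.mem_stabilizer_iff]
  refine h𝓕.eq_of_infinite_stabilizer hG (h𝓕.smul_mem h hF) hF
    (injective_zpow_of_injective hinj hn) ?_ ?_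
  · rintro _ ⟨i, rfl⟩
    exact Subgroup.zpow_mem _ h1 i
  · rintro _ ⟨i, rfl⟩
    exact Subgroup.zpow_mem _ (Subgroup.pow_mem _ (hAF ha) n) i

/-- Only finitely many distinguished flats meet a given compact set. -/
theorem IsIsolatedFlatsFamily.finite_meeting [Nonempty X] [ProperSpace X] (h𝓕 : IsIsolatedFlatsFamily 𝓕)
    {K : Set X} (hK : IsCompact K) : {F ∈ 𝓕 | (F ∩ K).Nonempty}.Finite := by
  obtain ⟨ψ, hψ⟩ := h𝓕.isolated
  by_contra hinf
  -- Each flat gets a pair of its points, one in `K`, at distance `ψ 1 + 1`. Infinitely many flats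
  -- would give two pairs within `1` of each other, and the intersection of the `1`-neighborhoods
  -- would be too wide.
  have hpq (F : Set X) (hF : F ∈ {F ∈ 𝓕 | (F ∩ K).Nonempty}) :
      ∃ c : X × X, c.1 ∈ F ∧ c.1 ∈ K ∧ c.2 ∈ F ∧ dist c.1 c.2 = ψ 1 + 1 := by
    obtain ⟨hF, p, hp, hpK⟩ := hF
    obtain ⟨q, hq, hd⟩ := (h𝓕.isFlat F hF).exists_dist_eq hp (show (0 : ℝ) ≤ ψ 1 + 1 by positivity)
    exact ⟨(p, q), hp, hpK, hq, hd⟩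
  choose! c hc1 hcK hc2 hcd using hpq
  have hcomp : IsCompact (K ×ˢ Metric.cthickening (ψ 1 + 1) K) := hK.prod hK.cthickening
  obtain ⟨t, -, htf, hcov⟩ := hcomp.finite_cover_balls (show (0 : ℝ) < 1 / 2 by norm_num)
  have hmem (F : Set X) (hF : F ∈ {F ∈ 𝓕 | (F ∩ K).Nonempty}) :
      ∃ u ∈ t, dist (c F) u < 1 / 2 := by
    obtain ⟨u, hu, hd⟩ := Set.mem_iUnion₂.1 (hcov (show c F ∈ K ×ˢ Metric.cthickening (ψ 1 + 1) K from ⟨hcK F hF,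
      Metric.mem_cthickening_of_dist_le _ _ _ _ (hcK F hF)
        (by rw [dist_comm, hcd F hF])⟩))
    exact ⟨u, hu, hd⟩
  choose! u hut hud using hmem
  obtain ⟨F₁, h₁, F₂, h₂, hne, heq⟩ := Set.Infinite.exists_ne_map_eq_of_mapsTo hinf hut htf
  have hd : dist (c F₁) (c F₂) ≤ 1 := by
    have := dist_triangle_right (c F₁) (c F₂) (u F₁)
    have h3 := hud F₂ h₂
    rw [← heq] at h3
    linarith [hud F₁ h₁]
  rw [Prod.dist_eq, max_le_iff] at hd
  have self_mem {F : Set X} {p : X} (hp : p ∈ F) : p ∈ Metric.cthickening ((1 : ℝ≥0) : ℝ) F :=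
    Metric.mem_cthickening_of_dist_le p p _ _ hp (by simp)
  have key := (Metric.edist_le_ediam_of_mem (x := (c F₁).1) (y := (c F₁).2)
    (s := Metric.cthickening ((1 : ℝ≥0) : ℝ) F₁ ∩ Metric.cthickening ((1 : ℝ≥0) : ℝ) F₂)
    ⟨self_mem (hc1 _ h₁), Metric.mem_cthickening_of_dist_le _ _ _ _ (hc1 _ h₂) hd.1⟩
    ⟨self_mem (hc2 _ h₁), Metric.mem_cthickening_of_dist_le _ _ _ _ (hc2 _ h₂) hd.2⟩).trans
    (hψ F₁ h₁.1 F₂ h₂.1 hne 1)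
  rw [edist_le_coe, ← NNReal.coe_le_coe, coe_nndist, hcd _ h₁] at key
  linarith

/-- The stabilizer of a distinguished flat acts coboundedly on it. -/
theorem IsIsolatedFlatsFamily.exists_dist_smul_le [Nonempty X] [ProperSpace X] (h𝓕 : IsIsolatedFlatsFamily 𝓕)
    (hG : IsGeometricAction G X) {F : Set X} (hF : F ∈ 𝓕) (p₀ : X) :
    ∃ C : ℝ, ∀ p ∈ F, ∃ g ∈ MulAction.stabilizer G F, dist p (g • p₀) ≤ C := by
  have := hG.isometric
  obtain ⟨K, hK, hKX⟩ := hG.cocompact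
  -- Only finitely many translates of `F` meet `K`. With a chosen `γ F'` for each, `g⁻¹ * γ (g • F)`
  -- corrects `g⁻¹` to an element of the stabilizer.
  set S := {F' | F' ∈ {F ∈ 𝓕 | (F ∩ K).Nonempty} ∧ ∃ g : G, g • F = F'} with hS
  have hSf : S.Finite := (h𝓕.finite_meeting hK).subset fun _ h => h.1
  have hex (F' : Set X) (hF' : F' ∈ S) : ∃ g : G, g • F = F' := hF'.2
  choose! γ hγ using hex
  have hbd : Bornology.IsBounded (K ∪ (fun F' => γ F' • p₀) '' S) :=
    hK.isBounded.union (hSf.image _).isBounded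
  refine ⟨Metric.diam (K ∪ (fun F' => γ F' • p₀) '' S), fun p hp => ?_⟩
  obtain ⟨g, hg⟩ := IsGeometricAction.exists_smul_mem hKX p
  have hgS : g • F ∈ S :=
    ⟨⟨h𝓕.smul_mem g hF, ⟨g • p, Set.smul_mem_smul_set hp, hg⟩⟩, g, rfl⟩
  refine ⟨g⁻¹ * γ (g • F), ?_, ?_⟩
  · rw [MulAction.mem_stabilizer_iff, mul_smul, hγ _ hgS, inv_smul_smul]
  · rw [← dist_smul g, smul_smul, mul_inv_cancel_left]
    exact Metric.dist_le_diam_of_mem hbd (Or.inl hg) (Or.inr ⟨_, hgS, rfl⟩)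

end

/-! ### From stabilizers of flats to Euclidean actions, and the main theorem. -/

/-- The action on `V` induced by an isometry `f : V → X` onto an invariant subset. -/
theorem exists_euclideanAction {Γ X V : Type*} [Group Γ] [MetricSpace X] [MulAction Γ X]
    [IsIsometricSMul Γ X] [NormedAddCommGroup V] [NormedSpace ℝ V] {f : V → X} (hf : Isometry f)
    (hinv : ∀ (g : Γ) (v : V), g • f v ∈ Set.range f) :
    ∃ ρ : EuclideanAction Γ V, ∀ g, f (ρ.trans g) = g • f 0 := by
  choose u hu using hinv
  have hmul (g h : Γ) (v : V) : u (g * h) v = u g (u h v) :=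
    hf.injective (by rw [hu, hu, hu, mul_smul])
  have hone (v : V) : u 1 v = v := hf.injective (by rw [hu, one_smul])
  have hiso (g : Γ) : Isometry (u g) := Isometry.of_dist_eq fun v w => by
    rw [← hf.dist_eq, hu, hu, dist_smul, hf.dist_eq]
  let e (g : Γ) : V ≃ᵢ V := IsometryEquiv.mk' (u g) (u g⁻¹)
    (fun v => by rw [← hmul, mul_inv_cancel, hone]) (hiso g)
  -- By the Mazur–Ulam theorem the induced bijective isometry is affine; `L g` is its linear part.
  let L (g : Γ) : V ≃ₗᵢ[ℝ] V := (e g).toRealAffineIsometryEquiv.linearIsometryEquiv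
  have hL (g : Γ) (v : V) : u g v = L g v + u g 0 := by
    have := (e g).toRealAffineIsometryEquiv.map_vadd 0 v
    rw [vadd_eq_add, add_zero, vadd_eq_add] at this
    exact this
  have hL' (g : Γ) (v : V) : L g v = u g v - u g 0 := by rw [hL g v, add_sub_cancel_right]
  exact ⟨{
    rot :=
      { toFun := fun g => ((L g).toContinuousLinearEquiv : V →L[ℝ] V)
        map_one' := by
          ext v
          change L 1 v = v
          rw [hL', hone, hone, sub_zero]
        map_mul' := fun g h => by
          ext v
          change L (g * h) v = L g (L h v)
          rw [hL' (g * h), hmul, hmul, hL' h, map_sub, hL' g, hL' g, sub_sub_sub_cancel_right] }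
    trans := fun g => u g 0
    norm_rot := fun g v => (L g).norm_map v
    trans_mul := fun g h => by
      change u (g * h) 0 = u g 0 + L g (u h 0)
      rw [hmul, hL g (u h 0), add_comm] }, fun g => hu g 0⟩

open scoped IsMulCommutative in
/-- The stabilizer of a distinguished flat is virtually abelian of rank at least two. -/
theorem IsIsolatedFlatsFamily.isVirtuallyAbelianOfRankGE_stabilizer {G X : Type*} [Group G]
    [MetricSpace X] [MulAction G X] {𝓕 : Set (Set X)} [Nonempty X] [ProperSpace X]
    (h𝓕 : IsIsolatedFlatsFamily 𝓕) (hG : IsGeometricAction G X) {F : Set X} (hF : F ∈ 𝓕) :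
    IsVirtuallyAbelianOfRankGE 2 (MulAction.stabilizer G F) := by
  have := hG.isometric
  obtain ⟨k, hk, f, hf, hfF⟩ := h𝓕.isFlat F hF
  obtain ⟨C, hC⟩ := h𝓕.exists_dist_smul_le hG hF (f 0)
  have : IsIsometricSMul (MulAction.stabilizer G F) X := ⟨fun g => isometry_smul X (g : G)⟩
  obtain ⟨ρ, hρ⟩ := exists_euclideanAction (Γ := MulAction.stabilizer G F) hf fun g v => by
    rw [hfF]
    exact smul_mem_of_mem_stabilizer g.2 (hfF ▸ ⟨v, rfl⟩)
  obtain ⟨A, hA, hfin, hrank⟩ := ρ.exists_abelian_finiteIndex (C := C)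
    (fun R => by
      refine Set.Finite.subset (Set.Finite.preimage Subtype.val_injective.injOn
        (hG.finite_smul_inter (isCompact_singleton (x := f 0)) (isCompact_closedBall (f 0) R))) ?_
      intro g hg
      refine ⟨f 0, rfl, ?_⟩
      change dist (g • f 0) (f 0) ≤ R
      rwa [← hρ, hf.dist_eq, dist_zero_right])
    (fun v => by
      obtain ⟨g, hg, hd⟩ := hC (f v) (hfF ▸ ⟨v, rfl⟩)
      refine ⟨⟨g, hg⟩, ?_⟩
      rw [← dist_eq_norm, ← hf.dist_eq, hρ]
      exact hd)
  refine ⟨A, hA, hfin, le_trans ?_ hrank⟩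
  rw [finrank_euclideanSpace_fin]
  exact_mod_cast hk

theorem subgroupConjClass_map_conj {G : Type*} [Group G] (H : Subgroup G) (g : G) :
    subgroupConjClass (H.map (MulAut.conj g).toMonoidHom) = subgroupConjClass H := by
  change Set.range (fun x : G => MulAut.conj x • (MulAut.conj g • H)) =
    Set.range fun x : G => MulAut.conj x • H
  have : (fun x : G => MulAut.conj x • (MulAut.conj g • H)) =
      (fun x : G => MulAut.conj x • H) ∘ Equiv.mulRight g := by
    funext x
    simp [smul_smul]
  rw [this, EquivLike.range_comp]

theorem theorem3p8 {G X : Type*} [Group G] [MetricSpace X] [Nonempty X] [MulAction G X]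
    (hX : IsCAT0Space X) (hG : IsGeometricAction G X)
    (𝓕 : Set (Set X)) (h𝓕 : IsIsolatedFlatsFamily 𝓕) :
    (subgroupConjClass '' maximalVirtuallyAbelianSubgroups G).Finite ∧
      maximalVirtuallyAbelianSubgroups G = {H | ∃ F ∈ 𝓕, H = MulAction.stabilizer G F} := by
  have := hG.isometric
  have := hG.properSpace hX.exists_geodesic
  have hmid := hX.exists_isCNMidpoint
  have hmax : maximalVirtuallyAbelianSubgroups G =
      {H | ∃ F ∈ 𝓕, H = MulAction.stabilizer G F} := by
    ext H
    constructor
    · intro hH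
      obtain ⟨F, hF, hle⟩ := h𝓕.exists_le_stabilizer hmid hG hH.1
      exact ⟨F, hF, le_antisymm hle
        (hH.2 (h𝓕.isVirtuallyAbelianOfRankGE_stabilizer hG hF) hle)⟩
    · rintro ⟨F, hF, rfl⟩
      have hVA := h𝓕.isVirtuallyAbelianOfRankGE_stabilizer hG hF
      refine ⟨hVA, fun H hH hle => ?_⟩
      obtain ⟨F', hF', hle'⟩ := h𝓕.exists_le_stabilizer hmid hG hH
      have : F = F' := h𝓕.eq_of_infinite_stabilizer hG hF hF' hVA.infinite
        (fun g hg => hg) fun g hg => hle' (hle hg)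
      rwa [this]
  refine ⟨?_, hmax⟩
  obtain ⟨K, hK, hKX⟩ := hG.cocompact
  rw [hmax]
  refine ((h𝓕.finite_meeting hK).image
    fun F => subgroupConjClass (MulAction.stabilizer G F)).subset ?_
  rintro _ ⟨_, ⟨F, hF, rfl⟩, rfl⟩
  obtain ⟨p, hp⟩ := (h𝓕.isFlat F hF).nonempty
  obtain ⟨g, hg⟩ := IsGeometricAction.exists_smul_mem hKX p
  refine ⟨g • F, ⟨h𝓕.smul_mem g hF, g • p, Set.smul_mem_smul_set hp, hg⟩, ?_⟩
  simp only
  rw [MulAction.stabilizer_smul_eq_stabilizer_map_conj, subgroupConjClass_map_conj]
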